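/- Let $F$ be a field of characteristic $p>2$, let $n\ge 3$, and let $t=(t_1,\dots,t_n)$ be an $n$-tuple of positive integers. Let $\Lambda(n,n)$ be the superalgebra with basis $x^{(\alpha)}x^u$ ($\alpha\in\mathbb N^n$, $u\subseteq\{n+1,\dots,2n\}$), the tensor product of the divided power algebra in the even variables $x_1,\dots,x_n$ (so $x^{(\alpha)}x^{(\beta)}=\binom{\alpha+\beta}{\alpha}x^{(\alpha+\beta)}$) and the Grassmann algebra in the odd variables $x_{n+1},\dots,x_{2n}$; here $x^u$ is the product of the $x_i$, $i\in u$, in increasing order. Write $d(\cdot)$ for parity, put $\tau(i)=\bar 0$ for $i\le n$ and $\tau(i)=\bar 1$ for $i>n$, and let $i'=i+n$ for $i\le n$, $i'=i-n$ for $i>n$. Let $D_1,\dots,D_{2n}$ be the superderivations of $\Lambda(n,n)$ with $D_i(x^{(\alpha)}x^u)=x^{(\alpha-\varepsilon_i)}x^u$ (zero if $\alpha_i=0$) for $i\le n$ and $D_i(x^{(\alpha)}x^u)=x^{(\alpha)}\partial_i(x^u)$ for $i>n$, where $\partial_i$ is the odd superderivation of the Grassmann algebra with $\partial_i(x_j)=\delta_{ij}$.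 Let $W(n,n)=\{\sum_i f_iD_i\mid f_i\in\Lambda(n,n)\}$ be the Lie superalgebra with bracket $$[fD_i,gD_j]=fD_i(g)D_j-(-1)^{d(fD_i)d(gD_j)}gD_j(f)D_i .$$ Let $\Lambda(n,n;t)$ be the span of the $x^{(\alpha)}x^u$ with $\alpha_i\le p^{t_i}-1$ for all $i$, and $W(n,n;t)=\{\sum_i f_iD_i\mid f_i\in\Lambda(n,n;t)\}$. Let $T_H$ be the linear map $T_H(f)=\sum_{i=1}^{2n}(-1)^{\tau(i)d(f)}D_i(f)D_{i'}$ and $\mathrm{div}$ the linear map $\mathrm{div}(fD_i)=(-1)^{\tau(i)d(f)}D_i(f)$ ($f$ homogeneous). Put $$SHO'=\{E\in W(n,n;t)\mid \mathrm{div}(E)=0\}\cap T_H(\Lambda(n,n;t)),\quad \overline{SHO}=[SHO',SHO'],\quad SHO=SHO(n,n;t)=[\overline{SHO},\overline{SHO}].$$ For a Lie superalgebra $L$, a skew-symmetric super-biderivation of parity $\gamma\in\mathbb Z/2$ is a bilinear map $\phi:L\times L\to L$ with $\phi(L_\alpha,L_\beta)\subseteq L_{\alpha+\beta+\gamma}$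 such that, for all homogeneous $x,y,z\in L$, $$\phi(x,[y,z])=[\phi(x,y),z]+(-1)^{(\gamma+d(x))d(y)}[y,\phi(x,z)],\qquad \phi(x,y)=-(-1)^{\gamma d(x)+\gamma d(y)+d(x)d(y)}\phi(y,x).$$ Let $\mathrm{BDer}(L)=\mathrm{BDer}_{\bar0}(L)\oplus\mathrm{BDer}_{\bar1}(L)$, where $\mathrm{BDer}_\gamma(L)$ is the space of those of parity $\gamma$, and let $\mathrm{IBDer}(L)$ be the set of the maps $\phi(x,y)=\lambda[x,y]$ with $\lambda\in F$. Theorem. $\mathrm{BDer}(SHO)=\mathrm{IBDer}(SHO)$. That is, the skew-symmetric super-biderivations of $SHO$ (sums of an even and an odd one) are exactly the maps $\phi(x,y)=\lambda[x,y]$ with $\lambda\in F$. -/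

import Mathlib

namespace OddHamiltonian

noncomputable section

/-! ### The superalgebra of divided powers and Grassmann variables -/

/-- The index set `Y = Y₀ ∪ Y₁`: `Sum.inl k` stands for the even index `k + 1`, and `Sum.inr k`
for the odd index `n + k + 1`. -/
abbrev Y (n : ℕ) : Type := Fin n ⊕ Fin n

/-- The involution `i ↦ i'` of `Y`, exchanging `i` and `i + n`. -/
def dual {n : ℕ} : Y n ≃ Y n := Equiv.sumComm (Fin n) (Fin n)

/-- The parity of an index. -/
def tau {n : ℕ} : Y n → ZMod 2
  | Sum.inl _ => 0
  | Sum.inr _ => 1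

/-- The sign `(-1)^a` of `a ∈ ℤ/2`. -/
def sgn (F : Type*) [Field F] (a : ZMod 2) : F := if a = 0 then 1 else -1

/-- The monomials `x^(α) x^u`: a multi-index `α` of divided powers of the even variables, and the
set `u` of odd variables that occur (written in increasing order). -/
abbrev Mon (n : ℕ) : Type := (Fin n → ℕ) × Finset (Fin n)

/-- `Λ(n,n)`, the divided power algebra in `n` even variables tensored with the Grassmann algebra in
`n` odd variables, as the space with basis the monomials. Its product is `mul` below. -/
abbrev Lam (F : Type*) [Field F] (n : ℕ) : Type _ := Mon n →₀ F

/-- The number of pairs `(i, j) ∈ u × v` with `j < i`, that is, the number of transpositions that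
put `x^u x^v` in increasing order. -/
def inversions {n : ℕ} (u v : Finset (Fin n)) : ℕ :=
  ((u ×ˢ v).filter (fun q => q.2 < q.1)).card

/-- The product `x^(α) x^u · x^(β) x^v`, which is `± (α+β choose α) x^(α+β) x^(u∪v)` if `u` and `v`
are disjoint, and `0` otherwise. -/
def mulMon (F : Type*) [Field F] {n : ℕ} (m m' : Mon n) : Lam F n :=
  if Disjoint m.2 m'.2 then
    Finsupp.single (m.1 + m'.1, m.2 ∪ m'.2)
      ((∏ i, ((m.1 i + m'.1 i).choose (m.1 i) : F)) * (-1) ^ inversions m.2 m'.2)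
  else 0

/-- The product of `Λ(n,n)`. -/
def mul (F : Type*) [Field F] (n : ℕ) : Lam F n →ₗ[F] Lam F n →ₗ[F] Lam F n :=
  Finsupp.linearCombination F (fun m => Finsupp.linearCombination F (fun m' => mulMon F m m'))

/-- `D_i` on monomials. -/
def DMon (F : Type*) [Field F] {n : ℕ} : Y n → Mon n → Lam F n
  | Sum.inl i, m => if m.1 i = 0 then 0 else Finsupp.single (m.1 - Pi.single i 1, m.2) 1
  | Sum.inr i, m =>
      if i ∈ m.2 then Finsupp.single (m.1, m.2.erase i) ((-1) ^ (m.2.filter (· < i)).card) else 0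

/-- The superderivations `D_1, …, D_{2n}` of `Λ(n,n)`. -/
def D (F : Type*) [Field F] {n : ℕ} (i : Y n) : Lam F n →ₗ[F] Lam F n :=
  Finsupp.linearCombination F (DMon F i)

/-- The projection of `Λ(n,n)` onto its component of parity `a`. -/
def proj (F : Type*) [Field F] (n : ℕ) (a : ZMod 2) : Lam F n →ₗ[F] Lam F n :=
  Finsupp.linearCombination F (fun m => if (m.2.card : ZMod 2) = a then Finsupp.single m 1 else 0)

/-! ### The Lie superalgebra `W(n,n)` -/

/-- `W(n,n)`; the family `(f_i)` stands for `∑ i, f_i D_i`. -/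
abbrev W (F : Type*) [Field F] (n : ℕ) : Type _ := Y n → Lam F n

/-- The action of `∑ i, f_i D_i` on `Λ(n,n)`. -/
def act (F : Type*) [Field F] (n : ℕ) : W F n →ₗ[F] Lam F n →ₗ[F] Lam F n :=
  ∑ i, (mul F n).compl₂ (D F i) ∘ₗ LinearMap.proj i

/-- The projection of `W(n,n)` onto its component of parity `a`; `f D_i` has the parity of `f` plus
that of `i`. -/
def wproj (F : Type*) [Field F] (n : ℕ) (a : ZMod 2) : W F n →ₗ[F] W F n :=
  LinearMap.pi (fun i => proj F n (a + tau i) ∘ₗ LinearMap.proj i)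

/-- The bracket of `W(n,n)`, the bilinear map given on homogeneous `f D_i`, `g D_j` by
`[f D_i, g D_j] = f D_i(g) D_j - (-1)^{d(f D_i) d(g D_j)} g D_j(f) D_i`. -/
def bracket (F : Type*) [Field F] (n : ℕ) : W F n →ₗ[F] W F n →ₗ[F] W F n :=
  LinearMap.mk₂ F
    (fun A B j => ∑ a : ZMod 2, ∑ b : ZMod 2,
      (act F n (wproj F n a A) (wproj F n b B j)
        - sgn F (a * b) • act F n (wproj F n b B) (wproj F n a A j)))
    (by
      intro A A' B; funext j
      simp only [map_add, LinearMap.add_apply, Pi.add_apply, smul_add, ← Finset.sum_add_distrib]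
      refine Finset.sum_congr rfl fun a _ => Finset.sum_congr rfl fun b _ => ?_
      abel)
    (by
      intro c A B; funext j
      simp only [map_smul, LinearMap.smul_apply, Pi.smul_apply, Finset.smul_sum, smul_sub]
      refine Finset.sum_congr rfl fun a _ => Finset.sum_congr rfl fun b _ => ?_
      rw [smul_comm])
    (by
      intro A B B'; funext j
      simp only [map_add, LinearMap.add_apply, Pi.add_apply, smul_add, ← Finset.sum_add_distrib]
      refine Finset.sum_congr rfl fun a _ => Finset.sum_congr rfl fun b _ => ?_
      abel)
    (by
      intro c A B; funext j
      simp only [map_smul, LinearMap.smul_apply, Pi.smul_apply, Finset.smul_sum, smul_sub]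
      refine Finset.sum_congr rfl fun a _ => Finset.sum_congr rfl fun b _ => ?_
      rw [smul_comm])

/-- The linear map with `T_H(f) = ∑ i, (-1)^{τ(i) d(f)} D_i(f) D_{i'}` for homogeneous `f`. -/
def TH (F : Type*) [Field F] (n : ℕ) : Lam F n →ₗ[F] W F n :=
  LinearMap.pi (fun j =>
    ∑ a : ZMod 2, sgn F (tau (dual j) * a) • (D F (dual j) ∘ₗ proj F n a))

/-- The divergence, the linear map with `div(f D_i) = (-1)^{τ(i) d(f)} D_i(f)` for homogeneous
`f`. -/
def div (F : Type*) [Field F] (n : ℕ) : W F n →ₗ[F] Lam F n :=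
  ∑ i, ∑ a : ZMod 2, sgn F (tau i * a) • (D F i ∘ₗ proj F n a ∘ₗ LinearMap.proj i)

/-! ### The finite-dimensional superalgebras -/

/-- `Λ(n,n;t)`, the span of the monomials `x^(α) x^u` with `α_i ≤ p^{t_i} - 1`. -/
def LamT (F : Type*) [Field F] (p : ℕ) {n : ℕ} (t : Fin n → ℕ) : Submodule F (Lam F n) :=
  Submodule.span F
    {f | ∃ m : Mon n, (∀ i, m.1 i ≤ p ^ t i - 1) ∧ f = Finsupp.single m 1}

/-- `W(n,n;t)`. -/
def WT (F : Type*) [Field F] (p : ℕ) {n : ℕ} (t : Fin n → ℕ) : Submodule F (W F n) :=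
  Submodule.pi Set.univ (fun _ => LamT F p t)

/-- `HO(n,n;t)`. -/
def HO (F : Type*) [Field F] (p : ℕ) {n : ℕ} (t : Fin n → ℕ) : Submodule F (W F n) :=
  (LamT F p t).map (TH F n)

/-- `S'(n,n;t)`. -/
def S' (F : Type*) [Field F] (p : ℕ) {n : ℕ} (t : Fin n → ℕ) : Submodule F (W F n) :=
  WT F p t ⊓ LinearMap.ker (div F n)

/-- `SHO'(n,n;t) = S'(n,n;t) ∩ HO(n,n;t)`. -/
def SHO' (F : Type*) [Field F] (p : ℕ) {n : ℕ} (t : Fin n → ℕ) : Submodule F (W F n) :=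
  S' F p t ⊓ HO F p t

/-- `[A, A]`, the span of the brackets of elements of `A`. -/
def derived {F : Type*} [Field F] {n : ℕ} (A : Submodule F (W F n)) : Submodule F (W F n) :=
  Submodule.span F {z | ∃ x ∈ A, ∃ y ∈ A, z = bracket F n x y}

/-- `SHO‾(n,n;t) = [SHO'(n,n;t), SHO'(n,n;t)]`. -/
def SHObar (F : Type*) [Field F] (p : ℕ) {n : ℕ} (t : Fin n → ℕ) : Submodule F (W F n) :=
  derived (SHO' F p t)

/-- The special odd Hamiltonian superalgebra `SHO(n,n;t)`. -/
def SHO (F : Type*) [Field F] (p : ℕ) {n : ℕ} (t : Fin n → ℕ) : Submodule F (W F n) :=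
  derived (SHObar F p t)

/-! ### The bracket of `SHO(n,n;t)`: closure of the subspaces above -/

section Closure

variable {F : Type*} [Field F] {n : ℕ}

/-- The elements of `Λ(n,n)` that are homogeneous of parity `a`. -/
def Par (F : Type*) [Field F] (n : ℕ) (a : ZMod 2) : Submodule F (Lam F n) :=
  Submodule.span F {f | ∃ m : Mon n, (m.2.card : ZMod 2) = a ∧ f = Finsupp.single m 1}

theorem sgn_add (a b : ZMod 2) : sgn F (a + b) = sgn F a * sgn F b := by
  have h : ∀ a b : ZMod 2, (a = 0 ∧ b = 0 ∧ a + b = 0) ∨ (a = 0 ∧ b ≠ 0 ∧ a + b ≠ 0) ∨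
      (a ≠ 0 ∧ b = 0 ∧ a + b ≠ 0) ∨ (a ≠ 0 ∧ b ≠ 0 ∧ a + b = 0) := by decide
  unfold sgn
  rcases h a b with ⟨h1, h2, h3⟩ | ⟨h1, h2, h3⟩ | ⟨h1, h2, h3⟩ | ⟨h1, h2, h3⟩
  · rw [if_pos h1, if_pos h2, if_pos h3, one_mul]
  · rw [if_pos h1, if_neg h2, if_neg h3, one_mul]
  · rw [if_neg h1, if_pos h2, if_neg h3, mul_one]
  · rw [if_neg h1, if_neg h2, if_pos h3]; simp

theorem sgn_natCast (k : ℕ) : sgn F (k : ZMod 2) = (-1) ^ k := by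
  induction k with
  | zero => simp [sgn]
  | succ k ih => rw [Nat.cast_succ, sgn_add, ih, pow_succ]; simp [sgn]

theorem sgn_sq (a : ZMod 2) : sgn F a * sgn F a = 1 := by
  unfold sgn; split_ifs <;> simp

theorem tau_dual (i : Y n) : tau (dual i) = tau i + 1 := by
  rcases i with i | i
  · simp [dual, tau]
  · simp only [dual, tau, Equiv.sumComm_apply, Sum.swap_inr]; decide

theorem dual_dual (i : Y n) : dual (dual i) = i := by
  rcases i with i | i <;> simp [dual]

theorem mul_single (m m' : Mon n) :
    mul F n (Finsupp.single m 1) (Finsupp.single m' 1) = mulMon F m m' := by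
  simp [mul]

theorem D_single (i : Y n) (m : Mon n) : D F i (Finsupp.single m 1) = DMon F i m := by
  simp [D]

theorem proj_single (a : ZMod 2) (m : Mon n) :
    proj F n a (Finsupp.single m 1) =
      if (m.2.card : ZMod 2) = a then Finsupp.single m 1 else 0 := by
  simp [proj]

theorem single_mem_Par (m : Mon n) (c : F) :
    Finsupp.single m c ∈ Par F n (m.2.card : ZMod 2) := by
  have : Finsupp.single m c = c • Finsupp.single m (1 : F) := by simp
  rw [this]
  exact Submodule.smul_mem _ _ (Submodule.subset_span ⟨m, rfl, rfl⟩)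

theorem proj_of_mem {a b : ZMod 2} {f : Lam F n} (hf : f ∈ Par F n a) :
    proj F n b f = if a = b then f else 0 := by
  refine Submodule.span_induction ?_ ?_ ?_ ?_ hf
  · rintro _ ⟨m, rfl, rfl⟩
    rw [proj_single]
  · simp
  · intro x y _ _ hx hy
    rw [map_add, hx, hy]; split_ifs <;> simp
  · intro c x _ hx
    rw [map_smul, hx]; split_ifs <;> simp

theorem proj_mem (a : ZMod 2) (f : Lam F n) : proj F n a f ∈ Par F n a := by
  induction f using Finsupp.induction_linear with
  | zero => simp
  | add f g hf hg => rw [map_add]; exact add_mem hf hg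
  | single m c =>
    have : Finsupp.single m c = c • Finsupp.single m (1 : F) := by simp
    rw [this, map_smul, proj_single]
    refine Submodule.smul_mem _ _ ?_
    split_ifs with h
    · rw [← h]; exact single_mem_Par m 1
    · exact zero_mem _

theorem sum_proj (f : Lam F n) : ∑ a : ZMod 2, proj F n a f = f := by
  induction f using Finsupp.induction_linear with
  | zero => simp
  | add f g hf hg => simp only [map_add, Finset.sum_add_distrib, hf, hg]
  | single m c =>
    have : Finsupp.single m c = c • Finsupp.single m (1 : F) := by simp
    rw [this]
    simp only [map_smul, proj_single, ← Finset.smul_sum, Finset.sum_ite_eq, Finset.mem_univ, if_true]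

theorem D_mem {a : ZMod 2} {f : Lam F n} (i : Y n) (hf : f ∈ Par F n a) :
    D F i f ∈ Par F n (a + tau i) := by
  refine Submodule.span_induction ?_ ?_ ?_ ?_ hf
  · rintro _ ⟨m, rfl, rfl⟩
    rw [D_single]
    rcases i with i | i
    · simp only [DMon, tau, add_zero]
      split_ifs
      · exact zero_mem _
      · exact single_mem_Par (m.1 - Pi.single i 1, m.2) 1
    · simp only [DMon, tau]
      split_ifs with h
      · have := single_mem_Par (F := F) (m.1, m.2.erase i) ((-1) ^ (m.2.filter (· < i)).card)
        have h2 : (m.2.card : ZMod 2) + 1 = ((m.2.erase i).card : ZMod 2) := by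
          rw [← Finset.card_erase_add_one h, Nat.cast_add, Nat.cast_one, add_assoc]
          rw [show (1 + 1 : ZMod 2) = 0 by decide, add_zero]
        rw [h2]; exact this
      · exact zero_mem _
  · simp
  · intro x y _ _ hx hy
    rw [map_add]; exact add_mem hx hy
  · intro c x _ hx
    rw [map_smul]; exact Submodule.smul_mem _ _ hx

theorem inversions_erase_left {u v : Finset (Fin n)} {i : Fin n} (h : i ∈ u) :
    inversions u v = inversions (u.erase i) v + (v.filter (· < i)).card := by
  simp only [inversions, Finset.card_filter, Finset.sum_product]
  rw [← Finset.sum_erase_add _ _ h]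

theorem inversions_erase_right {u v : Finset (Fin n)} {i : Fin n} (h : i ∈ v) :
    inversions u v = inversions u (v.erase i) + (u.filter (i < ·)).card := by
  simp only [inversions, Finset.card_filter, Finset.sum_product_right]
  rw [← Finset.sum_erase_add _ _ h]

theorem inversions_comm {u v : Finset (Fin n)} (h : Disjoint u v) :
    inversions u v + inversions v u = u.card * v.card := by
  simp only [inversions, Finset.card_filter]
  rw [Finset.sum_product, Finset.sum_product_right, ← Finset.sum_add_distrib]
  simp only [← Finset.sum_add_distrib]
  rw [Finset.sum_congr rfl (g := fun _ => v.card), Finset.sum_const, smul_eq_mul]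
  intro i hi
  rw [Finset.sum_congr rfl (g := fun _ => 1), Finset.sum_const, smul_eq_mul, mul_one]
  intro j hj
  have hne : i ≠ j := fun e => Finset.disjoint_left.mp h hi (e ▸ hj)
  rcases lt_or_gt_of_ne hne with h1 | h1
  · simp [h1, not_lt.mpr h1.le]
  · simp [h1, not_lt.mpr h1.le]

theorem card_split (u : Finset (Fin n)) (i : Fin n) :
    (u.filter (· < i)).card + (u.filter (i < ·)).card + (if i ∈ u then 1 else 0) = u.card := by
  have h3 : (if i ∈ u then 1 else 0) = (u.filter (· = i)).card := by
    rw [Finset.filter_eq']; split_ifs <;> simp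
  rw [h3, Finset.card_eq_sum_ones u]
  simp only [Finset.card_filter, ← Finset.sum_add_distrib]
  refine Finset.sum_congr rfl fun j _ => ?_
  rcases lt_trichotomy j i with h | h | h
  · simp [h, h.ne, not_lt.mpr h.le]
  · simp [h]
  · simp [h, h.ne', not_lt.mpr h.le]

/-- Supercommutativity. -/
theorem mul_comm_par {a b : ZMod 2} {f g : Lam F n} (hf : f ∈ Par F n a) (hg : g ∈ Par F n b) :
    mul F n f g = sgn F (a * b) • mul F n g f := by
  refine Submodule.span_induction ?_ ?_ ?_ ?_ hf
  · rintro _ ⟨m, rfl, rfl⟩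
    refine Submodule.span_induction ?_ ?_ ?_ ?_ hg
    · rintro _ ⟨m', rfl, rfl⟩
      rw [mul_single, mul_single, ← Nat.cast_mul, sgn_natCast]
      simp only [mulMon]
      by_cases h : Disjoint m.2 m'.2
      · rw [if_pos h, if_pos h.symm, Finsupp.smul_single, add_comm m'.1, Finset.union_comm m'.2]
        congr 1
        rw [← inversions_comm h, pow_add, smul_eq_mul]
        have e : ∏ i, ((m'.1 i + m.1 i).choose (m'.1 i) : F)
            = ∏ i, ((m.1 i + m'.1 i).choose (m.1 i) : F) := by
          refine Finset.prod_congr rfl fun i _ => ?_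
          rw [add_comm, Nat.choose_symm_add]
        rw [e]
        have : ((-1 : F) ^ inversions m'.2 m.2) * (-1) ^ inversions m'.2 m.2 = 1 := by
          rw [← mul_pow]; simp
        linear_combination (-(∏ i, ((m.1 i + m'.1 i).choose (m.1 i) : F)) *
          (-1) ^ inversions m.2 m'.2) * this
      · rw [if_neg h, if_neg (fun h' => h h'.symm), smul_zero]
    · simp
    · intro x y _ _ hx hy
      simp only [map_add, LinearMap.add_apply, smul_add, hx, hy]
    · intro c x _ hx
      simp only [map_smul, LinearMap.smul_apply, hx]
      rw [smul_comm]
  · simp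
  · intro x y _ _ hx hy
    simp only [map_add, LinearMap.add_apply, smul_add, hx, hy]
  · intro c x _ hx
    simp only [map_smul, LinearMap.smul_apply, hx]
    rw [smul_comm]

theorem prod_choose_succ (α β : Fin n → ℕ) (i : Fin n) (hne : α i + β i ≠ 0) :
    (∏ k, ((α k + β k).choose (α k) : F)) =
      (if α i = 0 then 0 else
        ∏ k, (((α - Pi.single i 1 : Fin n → ℕ) k + β k).choose
          ((α - Pi.single i 1 : Fin n → ℕ) k) : F))
      + (if β i = 0 then 0 else
        ∏ k, ((α k + (β - Pi.single i 1 : Fin n → ℕ) k).choose (α k) : F)) := by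
  have h1 : ∀ γ : Fin n → ℕ, ∀ k ∈ Finset.univ.erase i, (γ - Pi.single i 1 : Fin n → ℕ) k = γ k := by
    intro γ k hk
    simp [Pi.single_eq_of_ne (Finset.ne_of_mem_erase hk)]
  have e1 := (Finset.mul_prod_erase Finset.univ
    (fun k => ((α k + β k).choose (α k) : F)) (Finset.mem_univ i)).symm
  have e2 := (Finset.mul_prod_erase Finset.univ
    (fun k => (((α - Pi.single i 1 : Fin n → ℕ) k + β k).choose
          ((α - Pi.single i 1 : Fin n → ℕ) k) : F)) (Finset.mem_univ i)).symm
  have e3 := (Finset.mul_prod_erase Finset.univ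
    (fun k => ((α k + (β - Pi.single i 1 : Fin n → ℕ) k).choose (α k) : F)) (Finset.mem_univ i)).symm
  rw [e1, e2, e3]
  have p2 : ∏ k ∈ Finset.univ.erase i, (((α - Pi.single i 1 : Fin n → ℕ) k + β k).choose
          ((α - Pi.single i 1 : Fin n → ℕ) k) : F)
      = ∏ k ∈ Finset.univ.erase i, ((α k + β k).choose (α k) : F) :=
    Finset.prod_congr rfl fun k hk => by rw [h1 α k hk]
  have p3 : ∏ k ∈ Finset.univ.erase i, ((α k + (β - Pi.single i 1 : Fin n → ℕ) k).choose (α k) : F)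
      = ∏ k ∈ Finset.univ.erase i, ((α k + β k).choose (α k) : F) :=
    Finset.prod_congr rfl fun k hk => by rw [h1 β k hk]
  rw [p2, p3]
  simp only [Pi.sub_apply, Pi.single_eq_same]
  rcases Nat.eq_zero_or_pos (α i) with ha | ha <;> rcases Nat.eq_zero_or_pos (β i) with hb | hb
  · omega
  · simp [ha, hb.ne']
  · simp [hb, ha.ne']
  · rw [if_neg ha.ne', if_neg hb.ne']
    obtain ⟨x, hx⟩ := Nat.exists_eq_succ_of_ne_zero ha.ne'
    obtain ⟨y, hy⟩ := Nat.exists_eq_succ_of_ne_zero hb.ne'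
    rw [hx, hy]
    have : (x.succ + y.succ).choose x.succ
        = (x.succ - 1 + y.succ).choose (x.succ - 1) + (x.succ + (y.succ - 1)).choose x.succ := by
      have := Nat.choose_succ_succ (x + y.succ) x
      simp only [Nat.succ_eq_add_one, Nat.add_sub_cancel] at *
      rw [show x + 1 + (y + 1) = x + (y + 1) + 1 by ring, this,
        show x + 1 + y = x + (y + 1) by ring]
    rw [this]; push_cast; ring

theorem add_sub_single {α β : Fin n → ℕ} {i : Fin n} (h : α i ≠ 0) :
    α + β - Pi.single i 1 = α - Pi.single i 1 + β := by
  funext k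
  simp only [Pi.sub_apply, Pi.add_apply]
  by_cases hk : k = i
  · subst hk; simp; omega
  · simp [Pi.single_eq_of_ne hk]

/-- `D_i` is a superderivation. -/
theorem D_mul_single (i : Y n) (m m' : Mon n) :
    D F i (mulMon F m m') = mul F n (DMon F i m) (Finsupp.single m' 1)
      + sgn F (tau i * (m.2.card : ZMod 2)) • mul F n (Finsupp.single m 1) (DMon F i m') := by
  have hs : ∀ (m : Mon n) (c : F), Finsupp.single m c = c • Finsupp.single m (1 : F) := by simp
  rcases i with i | i
  · obtain ⟨α, u⟩ := m
    obtain ⟨β, v⟩ := m'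
    simp only [tau, zero_mul, DMon, apply_ite (mul F n),
      apply_ite (mul F n (Finsupp.single (α, u) 1)), map_zero]
    rw [show sgn F 0 = 1 by simp [sgn], one_smul]
    have hL : (if α i = 0 then (0 : Lam F n →ₗ[F] Lam F n) else
          mul F n (Finsupp.single (α - Pi.single i 1, u) 1)) (Finsupp.single (β, v) 1)
        = if α i = 0 then 0 else mulMon F (α - Pi.single i 1, u) (β, v) := by
      split_ifs
      · rfl
      · rw [mul_single]
    rw [hL, mul_single]
    simp only [mulMon]
    by_cases hd : Disjoint u v
    · simp only [if_pos hd]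
      rw [hs, map_smul, D_single]
      simp only [DMon, Pi.add_apply]
      by_cases h0 : α i + β i = 0
      · rw [if_pos h0, if_pos (by omega), if_pos (by omega)]; simp
      · rw [if_neg h0, prod_choose_succ α β i h0]
        by_cases ha : α i = 0 <;> by_cases hb : β i = 0
        · omega
        · simp only [ha, hb, if_true, if_false, zero_add]
          rw [add_comm α β, add_sub_single hb, add_comm _ α]
          simp
        · simp only [ha, hb, if_true, if_false, add_zero]
          rw [add_sub_single ha]
          simp
        · simp only [ha, hb, if_false]
          rw [← add_sub_single ha, add_comm α (β - Pi.single i 1), ← add_sub_single hb, add_comm β α,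
            ← Finsupp.single_add, Finsupp.smul_single, smul_eq_mul, mul_one, ← add_mul]
    · simp [if_neg hd]
  · obtain ⟨α, u⟩ := m
    obtain ⟨β, v⟩ := m'
    simp only [tau, one_mul, DMon, sgn_natCast]
    have hL : mul F n (if i ∈ u then
          Finsupp.single (α, u.erase i) ((-1) ^ (u.filter (· < i)).card) else 0)
          (Finsupp.single (β, v) 1)
        = if i ∈ u then
          ((-1 : F) ^ (u.filter (· < i)).card) • mulMon F (α, u.erase i) (β, v) else 0 := by
      split_ifs
      · rw [hs, map_smul, LinearMap.smul_apply, mul_single]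
      · simp
    have hR : mul F n (Finsupp.single (α, u) 1) (if i ∈ v then
          Finsupp.single (β, v.erase i) ((-1) ^ (v.filter (· < i)).card) else 0)
        = if i ∈ v then
          ((-1 : F) ^ (v.filter (· < i)).card) • mulMon F (α, u) (β, v.erase i) else 0 := by
      split_ifs
      · rw [hs (β, v.erase i), map_smul, mul_single]
      · simp
    rw [hL, hR]
    have hsq : ∀ k : ℕ, ((-1 : F) ^ k) * (-1) ^ k = 1 := fun k => by rw [← mul_pow]; simp
    simp only [mulMon]
    set P := ∏ k, ((α k + β k).choose (α k) : F)
    have hcu := card_split u i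
    by_cases hu : i ∈ u <;> by_cases hv : i ∈ v
    · have hnd : ¬ Disjoint u v := fun h => Finset.disjoint_left.mp h hu hv
      simp only [hu, hv, hnd, if_true, if_false, map_zero] at hcu ⊢
      have hiff : Disjoint (u.erase i) v ↔ Disjoint u (v.erase i) := Finset.disjoint_erase_comm
      have hun : u.erase i ∪ v = u ∪ v.erase i := by
        ext k; simp only [Finset.mem_union, Finset.mem_erase]
        by_cases hk : k = i
        · subst hk; simp [hu, hv]
        · simp [hk]
      by_cases hd : Disjoint (u.erase i) v
      · rw [if_pos hd, if_pos (hiff.mp hd), hun]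
        simp only [Finsupp.smul_single, smul_eq_mul]
        rw [← Finsupp.single_add]
        symm
        rw [Finsupp.single_eq_zero]
        have a1 := inversions_erase_left (v := v) hu
        have a2 := inversions_erase_right (u := u) hv
        have key : (-1 : F) ^ (inversions (u.erase i) v + (v.filter (· < i)).card)
            = (-1 : F) ^ (inversions u (v.erase i) + (u.filter (i < ·)).card) := by
          rw [← a1, ← a2]
        rw [pow_add, pow_add] at key
        rw [← hcu, pow_add, pow_add, pow_one]
        have s1 := hsq (v.filter (· < i)).card
        have s2 := hsq (u.filter (i < ·)).card
        generalize (-1 : F) ^ inversions (u.erase i) v = A at *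
        generalize (-1 : F) ^ inversions u (v.erase i) = B at *
        generalize (-1 : F) ^ (v.filter (· < i)).card = C at *
        generalize (-1 : F) ^ (u.filter (i < ·)).card = E at *
        generalize (-1 : F) ^ (u.filter (· < i)).card = G at *
        linear_combination (-(G * P * A)) * s1 + G * P * C * key
      · rw [if_neg hd, if_neg (fun h => hd (hiff.mpr h))]; simp
    · simp only [hu, hv, if_true, if_false, smul_zero, add_zero] at hcu ⊢
      have hiff : Disjoint (u.erase i) v ↔ Disjoint u v := by
        rw [Finset.disjoint_erase_comm, Finset.erase_eq_of_notMem hv]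
      by_cases hd : Disjoint u v
      · rw [if_pos hd, if_pos (hiff.mpr hd), hs, map_smul, D_single]
        simp only [DMon, Finset.mem_union, hu, true_or, if_true, Finsupp.smul_single, smul_eq_mul]
        rw [Finset.erase_union_distrib, Finset.erase_eq_of_notMem hv]
        congr 1
        have : ((u ∪ v).filter (· < i)).card
            = (u.filter (· < i)).card + (v.filter (· < i)).card := by
          rw [Finset.filter_union, Finset.card_union_of_disjoint
            (Finset.disjoint_filter_filter hd)]
        rw [this, inversions_erase_left hu, pow_add, pow_add]
        have s1 := hsq (v.filter (· < i)).card
        generalize (-1 : F) ^ (v.filter (· < i)).card = C at *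
        linear_combination (P * (-1) ^ inversions (u.erase i) v *
          (-1) ^ (u.filter (· < i)).card) * s1
      · rw [if_neg hd, if_neg (fun h => hd (hiff.mp h))]; simp
    · simp only [hu, hv, if_true, if_false, zero_add, add_zero] at hcu ⊢
      have hiff : Disjoint u (v.erase i) ↔ Disjoint u v := by
        rw [← Finset.disjoint_erase_comm, Finset.erase_eq_of_notMem hu]
      by_cases hd : Disjoint u v
      · rw [if_pos hd, if_pos (hiff.mpr hd), hs, map_smul, D_single]
        simp only [DMon, Finset.mem_union, hv, or_true, if_true, Finsupp.smul_single, smul_eq_mul]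
        rw [Finset.erase_union_distrib, Finset.erase_eq_of_notMem hu]
        congr 1
        have : ((u ∪ v).filter (· < i)).card
            = (u.filter (· < i)).card + (v.filter (· < i)).card := by
          rw [Finset.filter_union, Finset.card_union_of_disjoint
            (Finset.disjoint_filter_filter hd)]
        rw [this, inversions_erase_right hv, ← hcu, pow_add, pow_add, pow_add]
        ring
      · rw [if_neg hd, if_neg (fun h => hd (hiff.mp h))]; simp
    · simp only [hu, hv, if_false, smul_zero, add_zero]
      split_ifs
      · rw [hs, map_smul, D_single]; simp [DMon, hu, hv]
      · simp

theorem D_mul {a : ZMod 2} {f : Lam F n} (i : Y n) (hf : f ∈ Par F n a) (g : Lam F n) :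
    D F i (mul F n f g) = mul F n (D F i f) g + sgn F (tau i * a) • mul F n f (D F i g) := by
  refine Submodule.span_induction ?_ ?_ ?_ ?_ hf
  · rintro _ ⟨m, rfl, rfl⟩
    induction g using Finsupp.induction_linear with
    | zero => simp
    | add f g hf hg => simp only [map_add, hf, hg, smul_add]; abel
    | single m' c =>
      have : Finsupp.single m' c = c • Finsupp.single m' (1 : F) := by simp
      rw [this]
      simp only [map_smul, mul_single, D_mul_single, D_single, smul_add]
      rw [smul_comm c]
  · simp
  · intro x y _ _ hx hy
    simp only [map_add, LinearMap.add_apply, smul_add, hx, hy]; abel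
  · intro c x _ hx
    simp only [map_smul, LinearMap.smul_apply, hx, smul_add]
    rw [smul_comm c]

/-- The `D_i` supercommute. -/
theorem D_comm (i j : Y n) (f : Lam F n) :
    D F i (D F j f) = sgn F (tau i * tau j) • D F j (D F i f) := by
  have hs : ∀ (m : Mon n) (c : F), Finsupp.single m c = c • Finsupp.single m (1 : F) := by simp
  induction f using Finsupp.induction_linear with
  | zero => simp
  | add f g hf hg => simp only [map_add, hf, hg, smul_add]
  | single m c =>
    rw [hs]
    simp only [map_smul]
    rw [smul_comm]
    congr 1
    obtain ⟨α, u⟩ := m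
    simp only [D_single]
    rcases i with i | i <;> rcases j with j | j
    · simp only [DMon, tau, zero_mul, apply_ite (D F (Sum.inl i : Y n)),
        apply_ite (D F (Sum.inl j : Y n)), D_single, map_zero]
      rw [show sgn F 0 = 1 by simp [sgn], one_smul]
      by_cases hij : i = j
      · subst hij; rfl
      · simp only [Pi.sub_apply, Pi.single_eq_of_ne hij, Pi.single_eq_of_ne (Ne.symm hij),
          tsub_zero]
        rw [tsub_right_comm]
        split_ifs <;> rfl
    · simp only [DMon, tau, zero_mul, apply_ite (D F (Sum.inl i : Y n)),
        apply_ite (D F (Sum.inr j : Y n)), D_single, map_zero]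
      rw [show sgn F 0 = 1 by simp [sgn], one_smul]
      split_ifs with h1 h2 h2
      · rw [hs, map_smul, D_single]; simp [DMon, h2]
      · rw [hs, map_smul, D_single]; simp [DMon, h2]
      · rfl
      · rfl
    · simp only [DMon, tau, mul_zero, apply_ite (D F (Sum.inr i : Y n)),
        apply_ite (D F (Sum.inl j : Y n)), D_single, map_zero]
      rw [show sgn F 0 = 1 by simp [sgn], one_smul]
      split_ifs with h1 h2 h2
      · rw [hs (α, u.erase i), map_smul, D_single]; simp [DMon, h1]
      · rfl
      · rw [hs (α, u.erase i), map_smul, D_single]; simp [DMon, h1]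
      · rfl
    · simp only [DMon, tau, mul_one, apply_ite (D F (Sum.inr i : Y n)),
        apply_ite (D F (Sum.inr j : Y n)), map_zero]
      rw [show sgn F 1 = -1 by simp [sgn], hs (α, u.erase i), hs (α, u.erase j), map_smul, map_smul,
        D_single, D_single]
      simp only [DMon]
      by_cases hij : i = j
      · subst hij; simp
      · simp only [Finset.mem_erase, ne_eq, hij, Ne.symm hij, not_false_eq_true, true_and]
        by_cases h1 : i ∈ u <;> by_cases h2 : j ∈ u
        · simp only [h1, h2, if_true, Finsupp.smul_single, smul_eq_mul]
          rw [Finset.erase_right_comm]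
          congr 1
          have ce : ∀ x y : Fin n, x ∈ u → y ≠ x → (u.filter (· < y)).card
              = ((u.erase x).filter (· < y)).card + (if x < y then 1 else 0) := by
            intro x y hx _
            rw [Finset.filter_erase]
            split_ifs with hlt
            · rw [Finset.card_erase_add_one]; simp [hx, hlt]
            · rw [Finset.erase_eq_of_notMem]; · rfl
              simp [hlt]
          rw [ce i j h1 (Ne.symm hij), ce j i h2 hij]
          rcases lt_or_gt_of_ne hij with h | h
          · simp only [h, not_lt.mpr h.le, if_true, if_false, pow_add]; ring
          · simp only [h, not_lt.mpr h.le, if_true, if_false, pow_add]; ring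
        · simp [h1, h2]
        · simp [h1, h2]
        · simp [h1, h2]

theorem act_apply (A : W F n) (g : Lam F n) : act F n A g = ∑ i, mul F n (A i) (D F i g) := by
  simp [act, LinearMap.sum_apply]

theorem TH_apply {a : ZMod 2} {f : Lam F n} (hf : f ∈ Par F n a) (j : Y n) :
    TH F n f j = sgn F (tau (dual j) * a) • D F (dual j) f := by
  simp only [TH, LinearMap.pi_apply, LinearMap.sum_apply, LinearMap.smul_apply,
    LinearMap.comp_apply, proj_of_mem hf]
  rw [Finset.sum_eq_single a]
  · simp
  · intro b _ hb; simp [Ne.symm hb]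
  · simp

theorem TH_mem {a : ZMod 2} {f : Lam F n} (hf : f ∈ Par F n a) (j : Y n) :
    TH F n f j ∈ Par F n (a + 1 + tau j) := by
  rw [TH_apply hf]
  have := D_mem (dual j) hf
  rw [tau_dual, show a + (tau j + 1) = a + 1 + tau j by ring] at this
  exact Submodule.smul_mem _ _ this

theorem wproj_of_mem {a b : ZMod 2} {A : W F n} (hA : ∀ j, A j ∈ Par F n (a + tau j)) :
    wproj F n b A = if a = b then A else 0 := by
  funext j
  simp only [wproj, LinearMap.pi_apply, LinearMap.comp_apply, LinearMap.proj_apply,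
    proj_of_mem (hA j), add_left_inj]
  split_ifs <;> rfl

theorem bracket_of_mem {a b : ZMod 2} {A B : W F n} (hA : ∀ j, A j ∈ Par F n (a + tau j))
    (hB : ∀ j, B j ∈ Par F n (b + tau j)) (j : Y n) :
    bracket F n A B j = act F n A (B j) - sgn F (a * b) • act F n B (A j) := by
  simp only [bracket, LinearMap.mk₂_apply, wproj_of_mem hA, wproj_of_mem hB]
  rw [Finset.sum_eq_single a, Finset.sum_eq_single b]
  · simp
  · intro c _ hc; simp [Ne.symm hc]
  · simp
  · intro c _ hc; simp [Ne.symm hc]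
  · simp

theorem mul_mem {a b : ZMod 2} {f g : Lam F n} (hf : f ∈ Par F n a) (hg : g ∈ Par F n b) :
    mul F n f g ∈ Par F n (a + b) := by
  refine Submodule.span_induction ?_ ?_ ?_ ?_ hf
  · rintro _ ⟨m, rfl, rfl⟩
    refine Submodule.span_induction ?_ ?_ ?_ ?_ hg
    · rintro _ ⟨m', rfl, rfl⟩
      rw [mul_single]
      simp only [mulMon]
      split_ifs with h
      · rw [← Nat.cast_add, ← Finset.card_union_of_disjoint h]
        exact single_mem_Par (m.1 + m'.1, m.2 ∪ m'.2) _
      · exact zero_mem _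
    · simp
    · intro x y _ _ hx hy
      rw [map_add]; exact add_mem hx hy
    · intro c x _ hx
      rw [map_smul]; exact Submodule.smul_mem _ _ hx
  · simp
  · intro x y _ _ hx hy
    rw [map_add]; exact add_mem hx hy
  · intro c x _ hx
    rw [map_smul]; exact Submodule.smul_mem _ _ hx

theorem act_TH_apply {a : ZMod 2} {f : Lam F n} (hf : f ∈ Par F n a) (g : Lam F n) :
    act F n (TH F n f) g =
      ∑ i, sgn F (tau (dual i) * a) • mul F n (D F (dual i) f) (D F i g) := by
  rw [act_apply]
  refine Finset.sum_congr rfl fun i _ => ?_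
  rw [TH_apply hf, map_smul, LinearMap.smul_apply]

theorem act_TH_mem {a b : ZMod 2} {f g : Lam F n} (hf : f ∈ Par F n a) (hg : g ∈ Par F n b) :
    act F n (TH F n f) g ∈ Par F n (a + b + 1) := by
  rw [act_TH_apply hf]
  refine Submodule.sum_mem _ fun i _ => Submodule.smul_mem _ _ ?_
  have := mul_mem (D_mem (dual i) hf) (D_mem i hg)
  rw [tau_dual] at this
  have e : ∀ a b c : ZMod 2, a + (c + 1) + (b + c) = a + b + 1 := by decide
  rw [e] at this
  exact this

theorem smul_congr_sgn {M : Type*} [AddCommGroup M] [Module F M] {a b : ZMod 2} (h : a = b) (x : M) :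
    sgn F a • x = sgn F b • x := by rw [h]

theorem bracket_TH_par {a b : ZMod 2} {f g : Lam F n} (hf : f ∈ Par F n a) (hg : g ∈ Par F n b) :
    bracket F n (TH F n f) (TH F n g) = TH F n (act F n (TH F n f) g) := by
  funext j
  rw [bracket_of_mem (TH_mem hf) (TH_mem hg), TH_apply (act_TH_mem hf hg), act_TH_apply hf,
    act_TH_apply hf, act_TH_apply hg, TH_apply hf, TH_apply hg, map_sum]
  rw [← Equiv.sum_comp dual (fun i => sgn F (tau (dual i) * b) • _)]
  rw [Finset.smul_sum, Finset.smul_sum, ← Finset.sum_sub_distrib]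
  refine Finset.sum_congr rfl fun i _ => ?_
  rw [dual_dual]
  simp only [map_smul]
  rw [D_mul _ (D_mem (dual i) hf), mul_comm_par (D_mem i hg) (D_mem (dual i) (D_mem (dual j) hf)), D_comm (dual i) (dual j) f,
    D_comm (dual j) i g]
  simp only [map_smul, LinearMap.smul_apply, smul_add, smul_smul, ← sgn_add, tau_dual]
  have e1 : ∀ x y a b : ZMod 2, (y + 1) * (a + b + 1) + (x + 1) * a + (y + 1) * (a + (x + 1))
      + (y + 1) * x = (x + 1) * a + (y + 1) * b := by decide
  have e2 : ∀ x y a b : ZMod 2, (a + 1) * (b + 1) + x * b + (y + 1) * a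
      + (b + x) * (a + (y + 1) + (x + 1)) + (x + 1) * (y + 1)
      = 1 + ((y + 1) * (a + b + 1) + (x + 1) * a) := by decide
  rw [sub_eq_add_neg, add_comm]
  congr 1
  · rw [← neg_smul]
    congr 1
    have : sgn F 1 = -1 := by simp [sgn]
    rw [← neg_one_mul, ← this, ← sgn_add]
    congr 1
    generalize tau i = x
    generalize tau j = y
    clear hf hg
    revert a b x y
    decide
  · apply smul_congr_sgn
    generalize tau i = x
    generalize tau j = y
    clear hf hg
    revert a b x y
    decide

theorem bracket_TH (f g : Lam F n) :
    bracket F n (TH F n f) (TH F n g) = TH F n (act F n (TH F n f) g) := by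
  rw [← sum_proj f, ← sum_proj g]
  simp only [map_sum, LinearMap.sum_apply]
  exact Finset.sum_congr rfl fun a _ => Finset.sum_congr rfl fun b _ =>
    bracket_TH_par (proj_mem b f) (proj_mem a g)

/-- The odd Laplacian `∑ i, D_i D_{i'}`. -/
def lap (F : Type*) [Field F] (n : ℕ) : Lam F n →ₗ[F] Lam F n :=
  ∑ i, D F i ∘ₗ D F (dual i)

theorem lap_apply (f : Lam F n) : lap F n f = ∑ i, D F i (D F (dual i) f) := by
  simp [lap, LinearMap.sum_apply]

theorem lap_mem {a : ZMod 2} {f : Lam F n} (hf : f ∈ Par F n a) : lap F n f ∈ Par F n (a + 1) := by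
  rw [lap_apply]
  refine Submodule.sum_mem _ fun i _ => ?_
  have := D_mem i (D_mem (dual i) hf)
  rw [tau_dual] at this
  have e : ∀ a b : ZMod 2, a + (b + 1) + b = a + 1 := by decide
  rwa [e] at this

theorem div_TH_par {a : ZMod 2} {f : Lam F n} (hf : f ∈ Par F n a) :
    div F n (TH F n f) = sgn F a • lap F n f := by
  simp only [div, LinearMap.sum_apply, LinearMap.smul_apply, LinearMap.comp_apply,
    LinearMap.proj_apply, proj_of_mem (TH_mem hf _)]
  rw [lap_apply, Finset.smul_sum]
  refine Finset.sum_congr rfl fun i _ => ?_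
  rw [Finset.sum_eq_single (a + 1 + tau i)]
  · rw [if_pos rfl, TH_apply hf, map_smul, smul_smul, ← sgn_add, tau_dual]
    apply smul_congr_sgn
    have e : ∀ a x : ZMod 2, x * (a + 1 + x) + (x + 1) * a = a := by decide
    exact e _ _
  · intro b _ hb; simp [Ne.symm hb]
  · simp

theorem lap_proj_of_div {f : Lam F n} (h : div F n (TH F n f) = 0) (b : ZMod 2) :
    lap F n (proj F n b f) = 0 := by
  have h1 : ∑ a : ZMod 2, sgn F a • lap F n (proj F n a f) = 0 := by
    rw [← h]
    conv_rhs => rw [← sum_proj f]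
    simp only [map_sum]
    exact Finset.sum_congr rfl fun a _ => (div_TH_par (proj_mem a f)).symm
  have h2 := congrArg (proj F n (b + 1)) h1
  simp only [map_sum, map_smul, map_zero, proj_of_mem (lap_mem (proj_mem _ f)), add_left_inj] at h2
  rw [Finset.sum_eq_single b (by intro c _ hc; simp [hc]) (by simp), if_pos rfl] at h2
  have h3 := congrArg (fun z => sgn F b • z) h2
  simpa [smul_smul, sgn_sq] using h3

theorem lap_D (k : Y n) (f : Lam F n) : lap F n (D F k f) = sgn F (tau k) • D F k (lap F n f) := by
  rw [lap_apply, lap_apply, map_sum, Finset.smul_sum]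
  refine Finset.sum_congr rfl fun i _ => ?_
  rw [D_comm (dual i) k, map_smul, D_comm i k, smul_smul, ← sgn_add, tau_dual]
  apply smul_congr_sgn
  have e : ∀ x y : ZMod 2, (x + 1) * y + x * y = y := by decide
  exact e _ _

theorem lap_mul {x : ZMod 2} {X : Lam F n} (hX : X ∈ Par F n x) (Z : Lam F n) :
    lap F n (mul F n X Z) = mul F n (lap F n X) Z + sgn F x • mul F n X (lap F n Z)
      + (∑ j, sgn F (tau (dual j) * x) • mul F n (D F j X) (D F (dual j) Z)
        + ∑ j, sgn F (tau (dual j) * x) • mul F n (D F j X) (D F (dual j) Z)) := by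
  have hre := Equiv.sum_comp dual (fun j : Y n => sgn F (tau (dual j) * x) •
      mul F n (D F j X) (D F (dual j) Z))
  nth_rewrite 1 [← hre]
  rw [lap_apply, lap_apply, lap_apply, map_sum, map_sum, LinearMap.sum_apply, Finset.smul_sum,
    ← Finset.sum_add_distrib, ← Finset.sum_add_distrib, ← Finset.sum_add_distrib]
  refine Finset.sum_congr rfl fun j _ => ?_
  rw [D_mul _ hX, map_add, map_smul, D_mul _ hX, D_mul _ (D_mem (dual j) hX), dual_dual, smul_add,
    smul_smul, ← sgn_add]
  have e1 : tau j * (x + tau (dual j)) = tau j * x := by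
    rw [tau_dual]
    have e : ∀ x y : ZMod 2, y * (x + (y + 1)) = y * x := by decide
    exact e _ _
  have e2 : tau (dual j) * x + tau j * x = x := by
    rw [tau_dual]
    have e : ∀ x y : ZMod 2, (y + 1) * x + y * x = x := by decide
    exact e _ _
  rw [e1, e2]
  abel

theorem lap_act {a : ZMod 2} {f g : Lam F n} (hf : f ∈ Par F n a)
    (hf0 : lap F n f = 0) (hg0 : lap F n g = 0) : lap F n (act F n (TH F n f) g) = 0 := by
  set T : Y n → Y n → Lam F n := fun i j =>
    sgn F (tau (dual i) * a + tau (dual j) * (a + tau (dual i))) •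
      mul F n (D F j (D F (dual i) f)) (D F (dual j) (D F i g)) with hT
  have h1 : lap F n (act F n (TH F n f) g) = ∑ i, ∑ j, T i j + ∑ i, ∑ j, T i j := by
    rw [act_TH_apply hf, map_sum, ← Finset.sum_add_distrib]
    refine Finset.sum_congr rfl fun i _ => ?_
    rw [map_smul, lap_mul (D_mem (dual i) hf), lap_D, lap_D, hf0, hg0]
    simp only [map_zero, smul_zero, LinearMap.zero_apply, zero_add, smul_add, Finset.smul_sum,
      smul_smul, ← sgn_add, hT]
  have h2 : ∑ i, ∑ j, T i j = -∑ i, ∑ j, T i j := by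
    conv_rhs =>
      rw [← Equiv.sum_comp dual]
      enter [1, 2, i]
      rw [← Equiv.sum_comp dual]
    rw [Finset.sum_comm, ← Finset.sum_neg_distrib]
    refine Finset.sum_congr rfl fun j _ => ?_
    rw [← Finset.sum_neg_distrib]
    refine Finset.sum_congr rfl fun i _ => ?_
    simp only [hT, dual_dual]
    rw [D_comm j (dual i) f, D_comm (dual j) i g]
    simp only [map_smul, LinearMap.smul_apply, smul_smul, ← sgn_add, tau_dual]
    rw [← neg_smul]
    congr 1
    have : sgn F 1 = -1 := by simp [sgn]
    rw [← neg_one_mul, ← this, ← sgn_add]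
    congr 1
    generalize tau i = x
    generalize tau j = y
    clear hT T h1 hf
    revert a x y
    decide
  rw [h1]
  nth_rewrite 1 [h2]
  exact neg_add_cancel _

theorem div_TH_act {f g : Lam F n} (hf : div F n (TH F n f) = 0) (hg : div F n (TH F n g) = 0) :
    div F n (TH F n (act F n (TH F n f) g)) = 0 := by
  conv_lhs => rw [← sum_proj f, ← sum_proj g]
  simp only [map_sum, LinearMap.sum_apply]
  refine Finset.sum_eq_zero fun b _ => Finset.sum_eq_zero fun a _ => ?_
  rw [div_TH_par (act_TH_mem (proj_mem a f) (proj_mem b g)),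
    lap_act (proj_mem a f) (lap_proj_of_div hf a) (lap_proj_of_div hg b), smul_zero]

theorem single_mem_LamT {p : ℕ} {t : Fin n → ℕ} {m : Mon n} (c : F)
    (h : ∀ i, m.1 i ≤ p ^ t i - 1) : Finsupp.single m c ∈ LamT F p t := by
  have : Finsupp.single m c = c • Finsupp.single m (1 : F) := by simp
  rw [this]
  exact Submodule.smul_mem _ _ (Submodule.subset_span ⟨m, h, rfl⟩)

theorem dvd_choose_of_le {p k a b : ℕ} (hp : p.Prime) (ha : a < p ^ k) (hb : b < p ^ k)
    (hab : p ^ k ≤ a + b) : p ∣ (a + b).choose a := by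
  apply Nat.dvd_of_factorization_pos
  rw [add_comm a b, Nat.factorization_choose' hp
    (lt_of_lt_of_le (Nat.lt_succ_self (Nat.log p (b + a))) (Nat.le_add_right _ k))]
  rw [← Nat.pos_iff_ne_zero, Finset.card_pos]
  refine ⟨k, ?_⟩
  rw [Finset.mem_filter, Finset.mem_Ico, Nat.mod_eq_of_lt ha, Nat.mod_eq_of_lt hb]
  refine ⟨⟨?_, by omega⟩, hab⟩
  by_contra h
  have : k = 0 := by omega
  subst this
  simp at ha hb hab
  omega

theorem mul_mem_LamT {p : ℕ} [hp : Fact p.Prime] [CharP F p] {t : Fin n → ℕ} {f g : Lam F n}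
    (hf : f ∈ LamT F p t) (hg : g ∈ LamT F p t) : mul F n f g ∈ LamT F p t := by
  refine Submodule.span_induction ?_ ?_ ?_ ?_ hf
  · rintro _ ⟨m, hm, rfl⟩
    refine Submodule.span_induction ?_ ?_ ?_ ?_ hg
    · rintro _ ⟨m', hm', rfl⟩
      rw [mul_single]
      simp only [mulMon]
      split_ifs with h
      · by_cases hle : ∀ i, m.1 i + m'.1 i ≤ p ^ t i - 1
        · exact single_mem_LamT (m := (m.1 + m'.1, m.2 ∪ m'.2)) _ hle
        · push Not at hle
          obtain ⟨i, hi⟩ := hle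
          have hpos : 0 < p ^ t i := pow_pos hp.out.pos _
          have h0 : (((m.1 i + m'.1 i).choose (m.1 i) : ℕ) : F) = 0 := by
            rw [CharP.cast_eq_zero_iff F p]
            have h1 := hm i
            have h2 := hm' i
            exact dvd_choose_of_le (k := t i) hp.out (by omega) (by omega) (by omega)
          rw [Finset.prod_eq_zero (Finset.mem_univ i) h0]
          simp
      · exact zero_mem _
    · simp
    · intro x y _ _ hx hy
      rw [map_add]; exact add_mem hx hy
    · intro c x _ hx
      rw [map_smul]; exact Submodule.smul_mem _ _ hx
  · simp
  · intro x y _ _ hx hy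
    rw [map_add]; exact add_mem hx hy
  · intro c x _ hx
    rw [map_smul]; exact Submodule.smul_mem _ _ hx

theorem D_mem_LamT {p : ℕ} {t : Fin n → ℕ} {f : Lam F n} (i : Y n) (hf : f ∈ LamT F p t) :
    D F i f ∈ LamT F p t := by
  refine Submodule.span_induction ?_ ?_ ?_ ?_ hf
  · rintro _ ⟨m, hm, rfl⟩
    rw [D_single]
    rcases i with i | i
    · simp only [DMon]
      split_ifs
      · exact zero_mem _
      · exact single_mem_LamT (m := (m.1 - Pi.single i 1, m.2)) _
          fun k => le_trans (Nat.sub_le _ _) (hm k)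
    · simp only [DMon]
      split_ifs
      · exact single_mem_LamT (m := (m.1, m.2.erase i)) _ hm
      · exact zero_mem _
  · simp
  · intro x y _ _ hx hy
    rw [map_add]; exact add_mem hx hy
  · intro c x _ hx
    rw [map_smul]; exact Submodule.smul_mem _ _ hx

theorem bracket_mem_SHO' {p : ℕ} [Fact p.Prime] [CharP F p] {t : Fin n → ℕ} {A B : W F n}
    (hA : A ∈ SHO' F p t) (hB : B ∈ SHO' F p t) : bracket F n A B ∈ SHO' F p t := by
  obtain ⟨⟨hA1, hA2⟩, f, hf, rfl⟩ := hA
  obtain ⟨⟨-, hB2⟩, g, hg, rfl⟩ := hB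
  have hact : act F n (TH F n f) g ∈ LamT F p t := by
    rw [act_apply]
    exact Submodule.sum_mem _ fun i _ => mul_mem_LamT (hA1 i trivial) (D_mem_LamT i hg)
  rw [bracket_TH]
  refine ⟨⟨fun j _ => ?_, ?_⟩, ⟨_, hact, rfl⟩⟩
  · rw [← bracket_TH, bracket_TH]
    simp only [TH, LinearMap.pi_apply, LinearMap.sum_apply, LinearMap.smul_apply,
      LinearMap.comp_apply]
    refine Submodule.sum_mem _ fun a _ => Submodule.smul_mem _ _ (D_mem_LamT _ ?_)
    refine Submodule.span_induction ?_ ?_ ?_ ?_ hact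
    · rintro _ ⟨m, hm, rfl⟩
      rw [proj_single]
      split_ifs
      · exact single_mem_LamT _ hm
      · exact zero_mem _
    · simp
    · intro x y _ _ hx hy
      rw [map_add]; exact add_mem hx hy
    · intro c x _ hx
      rw [map_smul]; exact Submodule.smul_mem _ _ hx
  · exact div_TH_act hA2 hB2

theorem derived_le {A : Submodule F (W F n)} (h : ∀ x ∈ A, ∀ y ∈ A, bracket F n x y ∈ A) :
    derived A ≤ A := by
  refine Submodule.span_le.mpr ?_
  rintro _ ⟨x, hx, y, hy, rfl⟩
  exact h x hx y hy

theorem bracket_mem_derived {A : Submodule F (W F n)}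
    (h : ∀ x ∈ A, ∀ y ∈ A, bracket F n x y ∈ A) :
    ∀ x ∈ derived A, ∀ y ∈ derived A, bracket F n x y ∈ derived A := fun x hx y hy =>
  Submodule.subset_span ⟨x, derived_le h hx, y, derived_le h hy, rfl⟩

theorem bracket_mem_SHO {p : ℕ} [Fact p.Prime] [CharP F p] {t : Fin n → ℕ} :
    ∀ x ∈ SHO F p t, ∀ y ∈ SHO F p t, bracket F n x y ∈ SHO F p t :=
  bracket_mem_derived (bracket_mem_derived fun _ hx _ hy => bracket_mem_SHO' hx hy)

end Closure

/-! ### The Lie superalgebra structure of `SHO(n,n;t)` -/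

/-- The restriction of a bilinear map to a subspace that is closed under it. -/
def restrictBilin {F V : Type*} [Field F] [AddCommGroup V] [Module F V] (br : V →ₗ[F] V →ₗ[F] V)
    (S : Submodule F V) (h : ∀ x ∈ S, ∀ y ∈ S, br x y ∈ S) : S →ₗ[F] S →ₗ[F] S :=
  LinearMap.mk₂ F (fun x y => ⟨br x y, h x x.2 y y.2⟩)
    (fun _ _ _ => Subtype.ext (by simp)) (fun _ _ _ => Subtype.ext (by simp))
    (fun _ _ _ => Subtype.ext (by simp)) (fun _ _ _ => Subtype.ext (by simp))

/-- The bracket of `SHO(n,n;t)`, the restriction of that of `W(n,n)`. -/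
def SHObracket (F : Type*) [Field F] (p : ℕ) [Fact p.Prime] [CharP F p] {n : ℕ} (t : Fin n → ℕ) :
    SHO F p t →ₗ[F] SHO F p t →ₗ[F] SHO F p t :=
  restrictBilin (bracket F n) (SHO F p t) bracket_mem_SHO

/-- The component of parity `a` of `SHO(n,n;t)`, its intersection with that of `W(n,n)`. -/
def SHOpar (F : Type*) [Field F] (p : ℕ) {n : ℕ} (t : Fin n → ℕ) (a : ZMod 2) :
    Submodule F (SHO F p t) :=
  (LinearMap.range (wproj F n a)).comap (SHO F p t).subtype


/-! ### Skew-symmetric super-biderivations -/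

section Biderivations

variable {F L : Type*} [Field F] [AddCommGroup L] [Module F L]

/-- `φ` is a skew-symmetric super-biderivation, homogeneous of parity `γ`, of the superspace
`L = par 0 ⊕ par 1` with bracket `br`. -/
structure IsSkewSuperBiderivation (par : ZMod 2 → Submodule F L) (br : L →ₗ[F] L →ₗ[F] L)
    (γ : ZMod 2) (φ : L →ₗ[F] L →ₗ[F] L) : Prop where
  homogeneous : ∀ a b : ZMod 2, ∀ x ∈ par a, ∀ y ∈ par b, φ x y ∈ par (a + b + γ)
  leibniz : ∀ a b c : ZMod 2, ∀ x ∈ par a, ∀ y ∈ par b, ∀ z ∈ par c,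
    φ x (br y z) = br (φ x y) z + sgn F ((γ + a) * b) • br y (φ x z)
  skew : ∀ a b : ZMod 2, ∀ x ∈ par a, ∀ y ∈ par b,
    φ x y = -(sgn F (γ * a + γ * b + a * b) • φ y x)

/-- The space of skew-symmetric super-biderivations of parity `γ`. -/
def BDerHom (par : ZMod 2 → Submodule F L) (br : L →ₗ[F] L →ₗ[F] L) (γ : ZMod 2) :
    Submodule F (L →ₗ[F] L →ₗ[F] L) where
  carrier := {φ | IsSkewSuperBiderivation par br γ φ}
  zero_mem' := ⟨by simp, by simp, by simp⟩
  add_mem' := by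
    intro φ ψ hφ hψ
    refine ⟨fun a b x hx y hy => ?_, fun a b c x hx y hy z hz => ?_, fun a b x hx y hy => ?_⟩
    · exact add_mem (hφ.homogeneous a b x hx y hy) (hψ.homogeneous a b x hx y hy)
    · simp only [LinearMap.add_apply, map_add, smul_add, hφ.leibniz a b c x hx y hy z hz,
        hψ.leibniz a b c x hx y hy z hz]
      abel
    · simp only [LinearMap.add_apply, smul_add, neg_add]
      rw [hφ.skew a b x hx y hy, hψ.skew a b x hx y hy]
  smul_mem' := by
    intro r φ hφ
    refine ⟨fun a b x hx y hy => ?_, fun a b c x hx y hy z hz => ?_, fun a b x hx y hy => ?_⟩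
    · exact Submodule.smul_mem _ r (hφ.homogeneous a b x hx y hy)
    · simp only [LinearMap.smul_apply, map_smul, hφ.leibniz a b c x hx y hy z hz, smul_add]
      rw [smul_comm]
    · simp only [LinearMap.smul_apply]
      rw [hφ.skew a b x hx y hy, smul_neg, smul_comm]

/-- `BDer(L) = BDer_0(L) ⊕ BDer_1(L)`, the space of skew-symmetric super-biderivations. -/
def BDer (par : ZMod 2 → Submodule F L) (br : L →ₗ[F] L →ₗ[F] L) :
    Submodule F (L →ₗ[F] L →ₗ[F] L) :=
  BDerHom par br 0 ⊔ BDerHom par br 1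

/-- `IBDer(L)`, the space of inner super-biderivations `φ(x, y) = c [x, y]`. -/
def IBDer (br : L →ₗ[F] L →ₗ[F] L) : Submodule F (L →ₗ[F] L →ₗ[F] L) where
  carrier := {φ | ∃ c : F, ∀ x y, φ x y = c • br x y}
  zero_mem' := ⟨0, by simp⟩
  add_mem' := by
    rintro φ ψ ⟨c, hc⟩ ⟨d, hd⟩
    exact ⟨c + d, fun x y => by simp [hc, hd, add_smul]⟩
  smul_mem' := by
    rintro r φ ⟨c, hc⟩
    exact ⟨r * c, fun x y => by simp [hc, mul_smul]⟩

end Biderivations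

end

end OddHamiltonian

/-!
The bracket of `L = SHO(n,n;t)` satisfies the axioms of a Lie superalgebra, which say exactly that it
is a skew-symmetric super-biderivation of parity `0` (`isSkewSuperBiderivation_SHObracket`; the Jacobi
identity holds because `W(n,n)` acts faithfully on `Λ(n,n)` and its bracket acts as the
supercommutator, `act_bracket`). So all multiples of it are super-biderivations.

Conversely, let `φ` be a skew-symmetric super-biderivation of parity `γ`. Expanding `φ([x,u],[y,v])`
in two ways gives `[φ(x,y),[u,v]] = ± [[x,y],φ(u,v)]` (`br_phi_br`, in characteristic other than `2`).
As no nonzero element of `L` commutes with `[L,L]`, the value `φ(x,y)` depends, up to sign, only on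
`[x,y]`: there is a linear map `g` with `φ(x,y) = ± g[x,y]` (`exists_factor`), and `g` belongs to the
centroid on brackets (`factor_br`, `factor_mem_centroid`). It remains to see that `g` is a scalar.

For this only finitely many elements of `L` are needed, and no description of `L` itself: the
Hamiltonian vector fields `X_c` of the generators `x_c` and `Q_ab` of the products `x_a x_b` with
`b ≠ a, a'`. Up to nonzero scalars, `[Q_ab, X_a'] = X_b` and `[Q_ac', Q_cb] = Q_ab` for
`c ≠ a, a', b, b'`; such a `c` exists as `n ≥ 3`. Hence these elements survive in all derived algebras
of `SHO'(n,n;t)`, and lie in `L` (`gen_quad_mem_SHO`). Moreover, an element of `L` that commutes with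
all `X_c` has constant coefficients, so it is a combination of the `X_c` (`eq_sum_of_commutes_gen`).
These properties are collected in `IsFrame`. Since `g(X_c)` commutes with the `X_e`, it is a
combination of them, and the action of the `Q_ab` shows that `g(X_c) = r X_c` with the same `r` for
all `c`, where `r = 0` if `φ` is odd (`IsFrame.exists_factor_X`). Subtracting `r` times the bracket
from `φ`, one may assume that `g` kills the `X_c`; then it maps all brackets to combinations of the
`X_c`, and comparing coefficients shows that it kills the `Q_ab`, and finally everything
(`IsFrame.eq_zero_of_factor_X_eq_zero`).
-/

namespace OddHamiltonian

/-! ### Skew super-biderivations and the centroid -/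

section AbstractBiderivations

variable {F L : Type*} [Field F] [AddCommGroup L] [Module F L]
  {par : ZMod 2 → Submodule F L} {br : L →ₗ[F] L →ₗ[F] L} {γ : ZMod 2} {φ : L →ₗ[F] L →ₗ[F] L}

theorem zmod_two_cases : ∀ a : ZMod 2, a = 0 ∨ a = 1 := by decide

theorem sgn_zero : sgn F 0 = 1 := by simp [sgn]

theorem sgn_one : sgn F 1 = -1 := by simp [sgn]

theorem one_add_one_zmod_two : (1 + 1 : ZMod 2) = 0 := by decide

/-- The Leibniz rule in the first argument. Its signs are those of a symbol `φ` written between the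
two arguments: `y` passes to the left of `φ` without a sign. -/
theorem leibniz_left (hB : IsSkewSuperBiderivation par br 0 br)
    (hφ : IsSkewSuperBiderivation par br γ φ) {a b c : ZMod 2} {x y z : L}
    (hx : x ∈ par a) (hy : y ∈ par b) (hz : z ∈ par c) :
    φ (br y z) x = br y (φ z x) + sgn F ((γ + a) * c) • br (φ y x) z := by
  have hyz := hB.homogeneous _ _ y hy z hz
  rw [hφ.skew _ _ _ hyz _ hx, hφ.leibniz _ _ _ _ hx _ hy _ hz, hφ.skew _ _ _ hx _ hy,
    hφ.skew _ _ _ hx _ hz]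
  simp only [map_neg, map_smul, LinearMap.neg_apply, LinearMap.smul_apply]
  rcases zmod_two_cases a with rfl | rfl <;> rcases zmod_two_cases b with rfl | rfl <;>
  rcases zmod_two_cases c with rfl | rfl <;> rcases zmod_two_cases γ with rfl | rfl <;>
  simp only [one_add_one_zmod_two, sgn_zero, sgn_one, mul_zero, mul_one, add_zero, zero_add] <;> module

/-- The defect `[φ(x,y),[u,v]] ∓ [[x,y],φ(u,v)]` is supersymmetric in `x` and `u`: both sides come
from the two ways of expanding `φ([x,u],[y,v])`. -/
theorem defect_swap (hB : IsSkewSuperBiderivation par br 0 br)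
    (hφ : IsSkewSuperBiderivation par br γ φ) {a b c d : ZMod 2} {x y u v : L}
    (hx : x ∈ par a) (hy : y ∈ par b) (hu : u ∈ par c) (hv : v ∈ par d) :
    br (φ x y) (br u v) - sgn F (γ * (b + c)) • br (br x y) (φ u v) =
      sgn F (a * c + (a + c) * (γ + b)) •
        (br (φ u y) (br x v) - sgn F (γ * (b + a)) • br (br u y) (φ x v)) := by
  have hxu := hB.homogeneous _ _ x hx u hu
  have hyv := hB.homogeneous _ _ y hy v hv
  have hxy := hφ.homogeneous _ _ x hx y hy
  have huv := hφ.homogeneous _ _ u hu v hv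
  have huy := hφ.homogeneous _ _ u hu y hy
  have hxv := hφ.homogeneous _ _ x hx v hv
  have key := leibniz_left hB hφ hyv hx hu
  rw [hφ.leibniz _ _ _ _ hxu _ hy _ hv, leibniz_left hB hφ hy hx hu, leibniz_left hB hφ hv hx hu,
    hφ.leibniz _ _ _ _ hu _ hy _ hv, hφ.leibniz _ _ _ _ hx _ hy _ hv] at key
  have J1 := hB.leibniz _ _ _ x hx _ huy v hv
  have J2 := hB.leibniz _ _ _ _ hxy _ hu v hv
  have J2' := hB.skew _ _ _ hu _ (hB.homogeneous _ _ _ hxy _ hv)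
  have J3 := hB.leibniz _ _ _ x hx _ hy _ huv
  have J4 := hB.leibniz _ _ _ y hy _ hxv _ hu
  have J5 := hB.skew _ _ _ hy _ hu
  have J6 := hB.skew _ _ _ hxv _ (hB.homogeneous _ _ _ hu _ hy)
  rw [J2'] at J2
  rw [J5] at J4
  simp only [map_add, map_neg, map_smul, LinearMap.smul_apply, LinearMap.add_apply] at key J1 J2 J3 J4 J6
  rw [J6] at J4
  rw [J1, J3, J4] at key
  rw [J2]
  rcases zmod_two_cases a with rfl | rfl <;> rcases zmod_two_cases b with rfl | rfl <;>
  rcases zmod_two_cases c with rfl | rfl <;> rcases zmod_two_cases d with rfl | rfl <;>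
  rcases zmod_two_cases γ with rfl | rfl <;>
  simp only [one_add_one_zmod_two, sgn_zero, sgn_one, mul_zero, mul_one, add_zero, zero_add] at key ⊢ <;>
  first
  | linear_combination (norm := module) key
  | linear_combination (norm := module) (-1 : F) • key

/-- `[φ(x,y),[u,v]] = ± [[x,y],φ(u,v)]`: the difference of the two sides is supersymmetric in `x` and
`u` and skew in `x` and `y`, so it vanishes in characteristic other than `2`. -/
theorem br_phi_br (h2 : (2 : F) ≠ 0) (hB : IsSkewSuperBiderivation par br 0 br)
    (hφ : IsSkewSuperBiderivation par br γ φ) {a b c d : ZMod 2} {x y u v : L}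
    (hx : x ∈ par a) (hy : y ∈ par b) (hu : u ∈ par c) (hv : v ∈ par d) :
    br (φ x y) (br u v) = sgn F (γ * (b + c)) • br (br x y) (φ u v) := by
  have flip : ∀ {a b c : ZMod 2} {x y u : L}, x ∈ par a → y ∈ par b →
      br (φ x y) (br u v) - sgn F (γ * (b + c)) • br (br x y) (φ u v) =
        -sgn F (γ * a + γ * b + a * b) •
          (br (φ y x) (br u v) - sgn F (γ * (a + c)) • br (br y x) (φ u v)) := by
    intro a b c x y u hx hy
    rw [hφ.skew _ _ _ hx _ hy, hB.skew _ _ _ hx _ hy]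
    simp only [map_neg, map_smul, LinearMap.neg_apply, LinearMap.smul_apply]
    rcases zmod_two_cases a with rfl | rfl <;> rcases zmod_two_cases b with rfl | rfl <;>
    rcases zmod_two_cases c with rfl | rfl <;> rcases zmod_two_cases γ with rfl | rfl <;>
    simp only [one_add_one_zmod_two, sgn_zero, sgn_one, mul_zero, mul_one, add_zero, zero_add] <;> module
  -- `(12) = (13)(23)(13)` with `(23) = (12)(13)(12)`: the defect is also symmetric in `x` and `y`
  have e1 := defect_swap hB hφ hx hy hu hv
  have e2 := flip (c := a) (u := x) hu hy
  have e3 := defect_swap hB hφ hy hu hx hv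
  have e4 := flip (c := b) (u := y) hx hu
  have e5 := defect_swap hB hφ hu hx hy hv
  have e6 := flip (c := c) (u := u) hy hx
  rw [← sub_eq_zero]
  set z := br (φ x y) (br u v) - sgn F (γ * (b + c)) • br (br x y) (φ u v) with hz
  rw [e2, e3, e4, e5, e6] at e1
  have : (2 : F) • z = 0 := by
    clear_value z
    clear e2 e3 e4 e5 e6 flip hz
    rcases zmod_two_cases a with rfl | rfl <;> rcases zmod_two_cases b with rfl | rfl <;>
    rcases zmod_two_cases c with rfl | rfl <;> rcases zmod_two_cases γ with rfl | rfl <;>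
    simp only [one_add_one_zmod_two, sgn_zero, sgn_one, mul_zero, mul_one, add_zero, zero_add] at e1 <;>
    linear_combination (norm := module) e1
  exact (smul_eq_zero.mp this).resolve_left h2

theorem homogeneous_induction (hC : IsCompl (par 0) (par 1)) {P : L → Prop}
    (hadd : ∀ x y, P x → P y → P (x + y)) (hom : ∀ a, ∀ x ∈ par a, P x) (x : L) : P x := by
  have hx : x ∈ par 0 ⊔ par 1 := by rw [hC.sup_eq_top]; trivial
  obtain ⟨y, hy, z, hz, rfl⟩ := Submodule.mem_sup.mp hx
  exact hadd _ _ (hom 0 y hy) (hom 1 z hz)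

/-- The parity operator to the power `γ`. -/
theorem exists_parity_twist (hC : IsCompl (par 0) (par 1)) (γ : ZMod 2) :
    ∃ σ : L →ₗ[F] L, ∀ a, ∀ x ∈ par a, σ x = sgn F (γ * a) • x := by
  refine ⟨LinearMap.ofIsCompl hC (sgn F (γ * 0) • (par 0).subtype)
    (sgn F (γ * 1) • (par 1).subtype), fun a x hx => ?_⟩
  rcases zmod_two_cases a with rfl | rfl
  · exact LinearMap.ofIsCompl_apply_left hC ⟨x, hx⟩
  · exact LinearMap.ofIsCompl_apply_right hC ⟨x, hx⟩

theorem exists_comp_eq_of_ker_le {U V V' : Type*} [AddCommGroup U] [Module F U] [AddCommGroup V]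
    [Module F V] [AddCommGroup V'] [Module F V'] (f : U →ₗ[F] V) (h : U →ₗ[F] V')
    (hle : LinearMap.ker f ≤ LinearMap.ker h) : ∃ g : V →ₗ[F] V', g ∘ₗ f = h := by
  obtain ⟨g, hg⟩ := LinearMap.exists_extend
    ((LinearMap.ker f).liftQ h hle ∘ₗ f.quotKerEquivRange.symm.toLinearMap)
  refine ⟨g, LinearMap.ext fun x => ?_⟩
  have h1 := LinearMap.congr_fun hg ⟨f x, LinearMap.mem_range_self f x⟩
  rw [LinearMap.comp_apply, Submodule.subtype_apply] at h1
  rw [LinearMap.comp_apply, h1, LinearMap.comp_apply, LinearEquiv.coe_coe,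
    LinearMap.quotKerEquivRange_symm_apply_image, Submodule.mkQ_apply, Submodule.liftQ_apply]

/-- Up to the sign that moves `φ` to the left of its first argument, a skew super-biderivation
factors through the bracket as soon as no nonzero element commutes with all brackets. -/
theorem exists_factor (h2 : (2 : F) ≠ 0) (hC : IsCompl (par 0) (par 1))
    (hB : IsSkewSuperBiderivation par br 0 br)
    (hZ : ∀ z, (∀ a b, ∀ u ∈ par a, ∀ v ∈ par b, br (br u v) z = 0) → z = 0)
    (hφ : IsSkewSuperBiderivation par br γ φ) :
    ∃ g : L →ₗ[F] L, ∀ a, ∀ x ∈ par a, ∀ y, φ x y = sgn F (γ * a) • g (br x y) := by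
  obtain ⟨σ, hσ⟩ := exists_parity_twist hC γ
  have hle : LinearMap.ker (TensorProduct.lift br) ≤
      LinearMap.ker (TensorProduct.lift (φ ∘ₗ σ)) := by
    intro w hw
    refine hZ _ fun a b u hu v hv => ?_
    have : br (br u v) ∘ₗ TensorProduct.lift (φ ∘ₗ σ) =
        sgn F (γ * b) • br (φ u v) ∘ₗ TensorProduct.lift br := by
      refine TensorProduct.ext' fun x y => ?_
      refine homogeneous_induction hC (P := fun x => (br (br u v) ∘ₗ TensorProduct.lift (φ ∘ₗ σ))
        (TensorProduct.tmul F x y) = (sgn F (γ * b) • br (φ u v) ∘ₗ TensorProduct.lift br)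
        (TensorProduct.tmul F x y))
        (fun x x' h h' => ?_) (fun c x hx => ?_) x
      · rw [TensorProduct.add_tmul, map_add, map_add, h, h']
      refine homogeneous_induction hC (P := fun y => (br (br u v) ∘ₗ TensorProduct.lift (φ ∘ₗ σ))
        (TensorProduct.tmul F x y) = (sgn F (γ * b) • br (φ u v) ∘ₗ TensorProduct.lift br)
        (TensorProduct.tmul F x y))
        (fun y y' h h' => ?_) (fun d y hy => ?_) y
      · rw [TensorProduct.tmul_add, map_add, map_add, h, h']
      · simp only [LinearMap.comp_apply, LinearMap.smul_apply, TensorProduct.lift.tmul, hσ c x hx,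
          map_smul, br_phi_br h2 hB hφ hu hv hx hy, smul_smul, ← sgn_add]
        exact smul_congr_sgn (by ring_nf; rw [show (2 : ZMod 2) = 0 from rfl]; ring) _
    have h1 := LinearMap.congr_fun this w
    rwa [LinearMap.smul_apply, LinearMap.comp_apply, LinearMap.comp_apply, LinearMap.mem_ker.mp hw,
      map_zero, smul_zero] at h1
  obtain ⟨g, hg⟩ := exists_comp_eq_of_ker_le _ _ hle
  refine ⟨g, fun a x hx y => ?_⟩
  have h1 := LinearMap.congr_fun hg (TensorProduct.tmul F x y)
  simp only [LinearMap.comp_apply, TensorProduct.lift.tmul, hσ a x hx, map_smul,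
    LinearMap.smul_apply] at h1
  rw [h1, smul_smul, sgn_sq, one_smul]

/-- The brackets of two homogeneous elements whose parities add up to `a`. -/
def homBrackets (par : ZMod 2 → Submodule F L) (br : L →ₗ[F] L →ₗ[F] L) (a : ZMod 2) : Set L :=
  {x | ∃ b c, ∃ u ∈ par b, ∃ v ∈ par c, b + c = a ∧ br u v = x}

theorem mem_par_of_mem_homBrackets (hB : IsSkewSuperBiderivation par br 0 br) {a : ZMod 2} {x : L}
    (hx : x ∈ homBrackets par br a) : x ∈ par a := by
  obtain ⟨b, c, u, hu, v, hv, rfl, rfl⟩ := hx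
  simpa using hB.homogeneous _ _ u hu v hv

theorem factor_mem_par (hφ : IsSkewSuperBiderivation par br γ φ) {g : L →ₗ[F] L}
    (hg : ∀ a, ∀ x ∈ par a, ∀ y, φ x y = sgn F (γ * a) • g (br x y)) {a : ZMod 2} {x : L}
    (hx : x ∈ homBrackets par br a) : g x ∈ par (γ + a) := by
  obtain ⟨b, c, u, hu, v, hv, rfl, rfl⟩ := hx
  have h := hφ.homogeneous _ _ u hu v hv
  rw [hg _ u hu, add_comm] at h
  have := Submodule.smul_mem _ (sgn F (γ * b)) h
  rwa [smul_smul, sgn_sq, one_smul] at this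

theorem factor_br (h2 : (2 : F) ≠ 0) (hB : IsSkewSuperBiderivation par br 0 br)
    (hφ : IsSkewSuperBiderivation par br γ φ) {g : L →ₗ[F] L}
    (hg : ∀ a, ∀ x ∈ par a, ∀ y, φ x y = sgn F (γ * a) • g (br x y)) {a b : ZMod 2} {x y : L}
    (hx : x ∈ homBrackets par br a) (hy : y ∈ homBrackets par br b) :
    br (g x) y = sgn F (γ * a) • br x (g y) := by
  obtain ⟨a1, a2, x1, hx1, x2, hx2, rfl, rfl⟩ := hx
  obtain ⟨b1, b2, y1, hy1, y2, hy2, rfl, rfl⟩ := hy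
  have h := br_phi_br h2 hB hφ hx1 hx2 hy1 hy2
  rw [hg _ _ hx1, hg _ _ hy1] at h
  simp only [map_smul, LinearMap.smul_apply] at h
  have h' := congrArg (fun z => sgn F (γ * a1) • z) h
  simp only [smul_smul, ← sgn_add] at h'
  rw [show γ * a1 + γ * a1 = 0 from CharTwo.add_self_eq_zero _, sgn_zero, one_smul] at h'
  rw [h']
  exact smul_congr_sgn (by ring_nf; rw [show (2 : ZMod 2) = 0 from rfl]; ring) _

/-- The factor `g` of a skew super-biderivation belongs to the centroid, on brackets. By the
Leibniz rule and `factor_br`, `g[x,[y,z]]` is the sum of two of the three cyclic versions of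
`[g x,[y,z]]`, so the Jacobi identity makes twice the sum of all three vanish. -/
theorem factor_mem_centroid (h2 : (2 : F) ≠ 0) (hB : IsSkewSuperBiderivation par br 0 br)
    (hφ : IsSkewSuperBiderivation par br γ φ) {g : L →ₗ[F] L}
    (hg : ∀ a, ∀ x ∈ par a, ∀ y, φ x y = sgn F (γ * a) • g (br x y)) {a b c : ZMod 2} {x y z : L}
    (hx : x ∈ homBrackets par br a) (hy : y ∈ homBrackets par br b)
    (hz : z ∈ homBrackets par br c) :
    g (br x (br y z)) = br (g x) (br y z) := by
  -- the Leibniz rule, rewritten by `factor_br`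
  have cyc : ∀ {a b c : ZMod 2} {x y z : L}, x ∈ homBrackets par br a → y ∈ homBrackets par br b →
      z ∈ homBrackets par br c → g (br x (br y z)) =
        - (sgn F (c * (a + b)) • br (g z) (br x y)) - sgn F (a * b + a * c) • br (g y) (br z x) := by
    intro a b c x y z hx hy hz
    have hx' := mem_par_of_mem_homBrackets hB hx
    have hy' := mem_par_of_mem_homBrackets hB hy
    have hz' := mem_par_of_mem_homBrackets hB hz
    have hL := hφ.leibniz _ _ _ _ hx' _ hy' _ hz'
    rw [hg _ _ hx', hg _ _ hx', hg _ _ hx'] at hL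
    have hxy : br x y ∈ homBrackets par br (a + b) := ⟨a, b, x, hx', y, hy', rfl, rfl⟩
    have hxz : br x z ∈ homBrackets par br (a + c) := ⟨a, c, x, hx', z, hz', rfl, rfl⟩
    have e1 := factor_br h2 hB hφ hg hxy hz
    have e2 := factor_br h2 hB hφ hg hy hxz
    have e3 := hB.skew _ _ _ (mem_par_of_mem_homBrackets hB hxy) _ (factor_mem_par hφ hg hz)
    have e4 := hB.skew _ _ _ hx' _ hz'
    rw [e3] at e1
    rw [e4] at e2
    simp only [map_smul, map_neg, LinearMap.smul_apply] at hL e2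
    rw [e1, e4] at hL
    simp only [map_smul, map_neg] at hL
    rcases zmod_two_cases a with rfl | rfl <;> rcases zmod_two_cases b with rfl | rfl <;>
    rcases zmod_two_cases c with rfl | rfl <;> rcases zmod_two_cases γ with rfl | rfl <;>
    simp only [one_add_one_zmod_two, sgn_zero, sgn_one, mul_zero, mul_one, add_zero, zero_add]
      at hL e2 ⊢ <;>
    first
    | linear_combination (norm := module) hL + e2
    | linear_combination (norm := module) hL - e2
    | linear_combination (norm := module) (-1 : F) • hL + e2
    | linear_combination (norm := module) (-1 : F) • hL - e2
  have c1 := cyc hx hy hz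
  have c2 := cyc hy hz hx
  have c3 := cyc hz hx hy
  have hx' := mem_par_of_mem_homBrackets hB hx
  have hy' := mem_par_of_mem_homBrackets hB hy
  have hz' := mem_par_of_mem_homBrackets hB hz
  have J : sgn F (a * c) • br x (br y z) + sgn F (b * a) • br y (br z x) +
      sgn F (c * b) • br z (br x y) = 0 := by
    have j1 := hB.leibniz _ _ _ _ hx' _ hy' _ hz'
    have j2 := hB.skew _ _ _ (hB.homogeneous _ _ _ hx' _ hy') _ hz'
    have j3 := hB.skew _ _ _ hx' _ hz'
    rw [j2, j3] at j1
    simp only [map_smul, map_neg] at j1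
    rw [j1]
    rcases zmod_two_cases a with rfl | rfl <;> rcases zmod_two_cases b with rfl | rfl <;>
    rcases zmod_two_cases c with rfl | rfl <;>
    simp only [one_add_one_zmod_two, sgn_zero, sgn_one, mul_zero, mul_one, add_zero, zero_add] <;>
    module
  have Jg := congrArg g J
  simp only [map_add, map_smul, map_zero] at Jg
  have key : (2 : F) • (g (br x (br y z)) - br (g x) (br y z)) = 0 := by
    rw [c1, c2, c3] at Jg
    rw [c1]
    clear c1 c2 c3 J cyc hx hy hz hx' hy' hz'
    rcases zmod_two_cases a with rfl | rfl <;> rcases zmod_two_cases b with rfl | rfl <;>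
    rcases zmod_two_cases c with rfl | rfl <;>
    simp only [one_add_one_zmod_two, sgn_zero, sgn_one, mul_zero, mul_one, add_zero, zero_add]
      at Jg ⊢ <;>
    first
    | linear_combination (norm := module) Jg
    | linear_combination (norm := module) (-1 : F) • Jg
  exact sub_eq_zero.mp ((smul_eq_zero.mp key).resolve_left h2)

end AbstractBiderivations

/-! ### Biderivations of a superalgebra with a frame -/

section Frames

variable {F L : Type*} [Field F] [AddCommGroup L] [Module F L] {n : ℕ}
  {par : ZMod 2 → Submodule F L} {br : L →ₗ[F] L →ₗ[F] L} {γ : ZMod 2} {φ : L →ₗ[F] L →ₗ[F] L}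
  {X : Y n → L} {Q : Y n → Y n → L}

/-- A frame of a superspace with bracket: elements `X c` and `Q a b` that multiply, up to nonzero
scalars, like the Hamiltonian vector fields of the generators `x_c` and of the products `x_a x_b`
with `b ≠ a, a'`, the `X c` being linearly independent and spanning their own centralizer. -/
structure IsFrame (par : ZMod 2 → Submodule F L) (br : L →ₗ[F] L →ₗ[F] L)
    (X : Y n → L) (Q : Y n → Y n → L) : Prop where
  X_mem : ∀ c, X c ∈ par (tau c + 1)
  Q_mem : ∀ a b, b ≠ a → b ≠ dual a → Q a b ∈ par (tau a + tau b + 1)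
  br_X_X : ∀ a b, br (X a) (X b) = 0
  br_Q_X_left : ∀ a b, b ≠ a → b ≠ dual a → ∃ ε : F, ε ≠ 0 ∧ br (Q a b) (X (dual a)) = ε • X b
  br_Q_X_right : ∀ a b, b ≠ a → b ≠ dual a → ∃ ε : F, br (Q a b) (X (dual b)) = ε • X a
  br_Q_X_of_ne : ∀ a b c, b ≠ a → b ≠ dual a → c ≠ dual a → c ≠ dual b → br (Q a b) (X c) = 0
  br_Q_Q : ∀ a b c, b ≠ a → b ≠ dual a → c ≠ a → c ≠ dual a → c ≠ b → c ≠ dual b →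
    ∃ ε : F, ε ≠ 0 ∧ br (Q a (dual c)) (Q c b) = ε • Q a b
  exists_coord : ∃ coord : Y n → L →ₗ[F] F, ∀ c d, coord c (X d) = if c = d then 1 else 0
  exists_sum : ∀ z, (∀ c, br (X c) z = 0) → ∃ v : Y n → F, z = ∑ c, v c • X c

theorem exists_ne_four (hn : 3 ≤ n) (a b c d : Y n) : ∃ e, e ≠ a ∧ e ≠ b ∧ e ≠ c ∧ e ≠ d := by
  have h : ({a, b, c, d} : Finset (Y n)).card < (Finset.univ : Finset (Y n)).card := by
    refine lt_of_le_of_lt Finset.card_le_four ?_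
    rw [Finset.card_univ, Fintype.card_sum, Fintype.card_fin]
    omega
  obtain ⟨e, -, he⟩ := Finset.exists_mem_notMem_of_card_lt_card h
  simp only [Finset.mem_insert, Finset.mem_singleton, not_or] at he
  exact ⟨e, he.1, he.2.1, he.2.2.1, he.2.2.2⟩

theorem ne_dual_comm {a b : Y n} (h : b ≠ dual a) : a ≠ dual b := fun e => h (by rw [e, dual_dual])

theorem smul_mem_homBrackets {a : ZMod 2} {x : L} (r : F) (hx : x ∈ homBrackets par br a) :
    r • x ∈ homBrackets par br a := by
  obtain ⟨b, c, u, hu, v, hv, h, rfl⟩ := hx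
  exact ⟨b, c, r • u, Submodule.smul_mem _ _ hu, v, hv, h, by simp⟩

namespace IsFrame

variable (hf : IsFrame par br X Q)
include hf

theorem br_Q_sum {a b : Y n} (h1 : b ≠ a) (h2 : b ≠ dual a) :
    ∃ ε δ : F, ε ≠ 0 ∧ ∀ v : Y n → F,
      br (Q a b) (∑ c, v c • X c) = (v (dual a) * ε) • X b + (v (dual b) * δ) • X a := by
  obtain ⟨ε, hε, e1⟩ := hf.br_Q_X_left a b h1 h2
  obtain ⟨δ, e2⟩ := hf.br_Q_X_right a b h1 h2
  refine ⟨ε, δ, hε, fun v => ?_⟩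
  rw [map_sum, Finset.sum_eq_add (dual a) (dual b) (fun h => h1 (dual.injective h).symm)]
  · rw [map_smul, map_smul, e1, e2, smul_smul, smul_smul]
  · rintro c - ⟨hc1, hc2⟩
    rw [map_smul, hf.br_Q_X_of_ne a b c h1 h2 hc1 hc2, smul_zero]
  · simp
  · simp

theorem X_eq_smul_br (hn : 3 ≤ n) (c : Y n) : ∃ d, c ≠ d ∧ c ≠ dual d ∧
    ∃ r : F, X c = r • br (Q d c) (X (dual d)) := by
  obtain ⟨d, hd1, hd2, -, -⟩ := exists_ne_four hn c (dual c) c c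
  obtain ⟨ε, hε, e⟩ := hf.br_Q_X_left d c hd1.symm (ne_dual_comm hd2)
  exact ⟨d, hd1.symm, ne_dual_comm hd2, ε⁻¹, by rw [e, smul_smul, inv_mul_cancel₀ hε, one_smul]⟩

theorem X_mem_homBrackets (hn : 3 ≤ n) (c : Y n) : X c ∈ homBrackets par br (tau c + 1) := by
  obtain ⟨d, h1, h2, r, h⟩ := hf.X_eq_smul_br hn c
  rw [h]
  refine smul_mem_homBrackets _ ⟨_, _, _, hf.Q_mem d c h1 h2, _, hf.X_mem _, ?_, rfl⟩
  rw [tau_dual]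
  generalize tau c = x
  generalize tau d = y
  revert x y
  decide

theorem Q_mem_homBrackets (hn : 3 ≤ n) {a b : Y n} (h1 : b ≠ a) (h2 : b ≠ dual a) :
    Q a b ∈ homBrackets par br (tau a + tau b + 1) := by
  obtain ⟨c, hc1, hc2, hc3, hc4⟩ := exists_ne_four hn a (dual a) b (dual b)
  obtain ⟨ε, hε, e⟩ := hf.br_Q_Q a b c h1 h2 hc1 hc2 hc3 hc4
  have : Q a b = ε⁻¹ • br (Q a (dual c)) (Q c b) := by
    rw [e, smul_smul, inv_mul_cancel₀ hε, one_smul]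
  rw [this]
  refine smul_mem_homBrackets _ ⟨_, _, _, hf.Q_mem a (dual c) (ne_dual_comm hc2).symm
    (fun h => hc1 (dual.injective h)), _, hf.Q_mem c b hc3.symm (ne_dual_comm hc4), ?_, rfl⟩
  rw [tau_dual]
  generalize tau a = x
  generalize tau b = y
  generalize tau c = z
  revert x y z
  decide

theorem eq_zero_of_commutes (hn : 3 ≤ n) {z : L} (hX : ∀ c, br (X c) z = 0)
    (hQ : ∀ a b, b ≠ a → b ≠ dual a → br (Q a b) z = 0) : z = 0 := by
  obtain ⟨v, rfl⟩ := hf.exists_sum z hX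
  obtain ⟨coord, hco⟩ := hf.exists_coord
  refine Finset.sum_eq_zero fun d _ => ?_
  obtain ⟨b, hb1, hb2, -, -⟩ := exists_ne_four hn d (dual d) d d
  obtain ⟨ε, δ, hε, h⟩ := hf.br_Q_sum hb2 (by rwa [dual_dual])
  have h' := congrArg (coord b) ((h v).symm.trans (hQ _ _ hb2 (by rwa [dual_dual])))
  simp only [map_add, map_smul, hco, if_true, if_neg hb2, dual_dual, smul_eq_mul, mul_one,
    mul_zero, add_zero, map_zero] at h'
  rw [(mul_eq_zero.mp h').resolve_right hε, zero_smul]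

theorem eq_zero_of_commutes_brackets (hn : 3 ≤ n) (z : L)
    (h : ∀ a b, ∀ u ∈ par a, ∀ v ∈ par b, br (br u v) z = 0) : z = 0 := by
  have h' : ∀ a, ∀ x ∈ homBrackets par br a, br x z = 0 := by
    rintro a _ ⟨b, c, u, hu, v, hv, -, rfl⟩
    exact h _ _ u hu v hv
  exact hf.eq_zero_of_commutes hn (fun c => h' _ _ (hf.X_mem_homBrackets hn c))
    (fun a b h1 h2 => h' _ _ (hf.Q_mem_homBrackets hn h1 h2))

theorem factor_X (hn : 3 ≤ n) (h2 : (2 : F) ≠ 0) (hB : IsSkewSuperBiderivation par br 0 br)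
    (hφ : IsSkewSuperBiderivation par br γ φ) {g : L →ₗ[F] L}
    (hg : ∀ a, ∀ x ∈ par a, ∀ y, φ x y = sgn F (γ * a) • g (br x y)) {a : ZMod 2} {x : L}
    (hx : x ∈ homBrackets par br a) (c : Y n) :
    g (br x (X c)) = sgn F (γ * a) • br x (g (X c)) := by
  obtain ⟨d, h1, h2', r, h⟩ := hf.X_eq_smul_br hn c
  rw [← factor_br h2 hB hφ hg hx (hf.X_mem_homBrackets hn c), h]
  simp only [map_smul]
  rw [factor_mem_centroid h2 hB hφ hg hx (hf.Q_mem_homBrackets hn h1 h2')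
    (hf.X_mem_homBrackets hn _)]

/-- The factor `g` preserves each line spanned by `X c`: `g (X c)` commutes with all `X e`, hence is
a combination of them, and it is killed by each `Q a b` that kills `X c`. -/
theorem factor_X_eq_smul (hn : 3 ≤ n) (h2 : (2 : F) ≠ 0)
    (hB : IsSkewSuperBiderivation par br 0 br)
    (hφ : IsSkewSuperBiderivation par br γ φ) {g : L →ₗ[F] L}
    (hg : ∀ a, ∀ x ∈ par a, ∀ y, φ x y = sgn F (γ * a) • g (br x y)) (c : Y n) :
    ∃ r : F, g (X c) = r • X c := by
  have key : ∀ {a : ZMod 2} {x : L}, x ∈ homBrackets par br a → br x (X c) = 0 →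
      br x (g (X c)) = 0 := by
    intro a x hx h0
    have h := hf.factor_X hn h2 hB hφ hg hx c
    rw [h0, map_zero] at h
    have h' := congrArg (fun z => sgn F (γ * a) • z) h
    simpa [smul_smul, sgn_sq] using h'.symm
  obtain ⟨v, hv⟩ := hf.exists_sum (g (X c))
    fun e => key (hf.X_mem_homBrackets hn e) (hf.br_X_X e c)
  obtain ⟨coord, hco⟩ := hf.exists_coord
  refine ⟨v c, hv.trans (Finset.sum_eq_single c (fun d _ hdc => ?_) (by simp))⟩
  -- `Q d' b` kills `X c` and maps `X d` to a nonzero multiple of `X b`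
  obtain ⟨b, hb1, hb2, hb3, -⟩ := exists_ne_four hn d (dual d) (dual c) d
  have hb1' : b ≠ dual (dual d) := by rwa [dual_dual]
  obtain ⟨ε, δ, hε, h⟩ := hf.br_Q_sum hb2 hb1'
  have h0 := key (hf.Q_mem_homBrackets hn hb2 hb1')
    (hf.br_Q_X_of_ne _ _ c hb2 hb1' (by rw [dual_dual]; exact hdc.symm) (ne_dual_comm hb3))
  rw [hv, h] at h0
  have h' := congrArg (coord b) h0
  simp only [map_add, map_smul, hco, if_true, if_neg hb2, dual_dual, smul_eq_mul, mul_one,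
    mul_zero, add_zero, map_zero] at h'
  rw [(mul_eq_zero.mp h').resolve_right hε, zero_smul]

theorem X_ne_zero (c : Y n) : X c ≠ 0 := by
  obtain ⟨coord, hco⟩ := hf.exists_coord
  intro h
  have := hco c c
  rw [h, map_zero, if_pos rfl] at this
  exact zero_ne_one this

/-- The scalars by which `g` acts on the `X c` agree, because an even `g` commutes with the `Q a b`,
which connect any two of the `X c`; for an odd `φ` they vanish, as `g` changes the parity. -/
theorem exists_factor_X (hn : 3 ≤ n) (h2 : (2 : F) ≠ 0) (hC : IsCompl (par 0) (par 1))
    (hB : IsSkewSuperBiderivation par br 0 br)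
    (hφ : IsSkewSuperBiderivation par br γ φ) {g : L →ₗ[F] L}
    (hg : ∀ a, ∀ x ∈ par a, ∀ y, φ x y = sgn F (γ * a) • g (br x y)) :
    ∃ r : F, (γ ≠ 0 → r = 0) ∧ ∀ c, g (X c) = r • X c := by
  choose r hr using hf.factor_X_eq_smul hn h2 hB hφ hg
  rcases zmod_two_cases γ with rfl | rfl
  · have step : ∀ b c, b ≠ c → b ≠ dual c → r b = r c := by
      intro b c h1 h2'
      have hb : b ≠ dual (dual c) := by rwa [dual_dual]
      obtain ⟨ε, hε, e⟩ := hf.br_Q_X_left (dual c) b h2' hb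
      rw [dual_dual] at e
      have h := hf.factor_X hn h2 hB hφ hg (hf.Q_mem_homBrackets hn h2' hb) c
      rw [hr c, map_smul, e, zero_mul, sgn_zero, one_smul, map_smul, hr b, smul_smul, smul_smul,
        mul_comm] at h
      exact mul_right_cancel₀ hε (smul_left_injective F (hf.X_ne_zero b) h)
    have hpos : 0 < n := by omega
    set c0 : Y n := Sum.inl ⟨0, hpos⟩
    refine ⟨r c0, fun h => absurd rfl h, fun c => ?_⟩
    rw [hr c]
    congr 1
    obtain ⟨e, he1, he2, he3, he4⟩ := exists_ne_four hn c (dual c) c0 (dual c0)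
    rw [← step e c he1 he2, step e c0 he3 he4]
  · refine ⟨0, fun _ => rfl, fun c => ?_⟩
    have m1 := factor_mem_par hφ hg (hf.X_mem_homBrackets hn c)
    have m2 := Submodule.smul_mem _ (r c) (hf.X_mem c)
    rw [← hr c] at m2
    rw [zero_smul]
    refine Submodule.disjoint_def.mp hC.disjoint _ ?_ ?_ <;>
    rcases zmod_two_cases (tau c) with h | h <;> rw [h] at m1 m2 <;> assumption

/-- If the factor `g` kills the `X c`, it maps brackets into their span; comparing coefficients in
`[g (Q a b), Q d' e] = ± [Q a b, g (Q d' e)]` shows that it kills the `Q a b` as well, and thus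
everything. -/
theorem eq_zero_of_factor_X_eq_zero (hn : 3 ≤ n) (h2 : (2 : F) ≠ 0) (hC : IsCompl (par 0) (par 1))
    (hB : IsSkewSuperBiderivation par br 0 br)
    (hφ : IsSkewSuperBiderivation par br γ φ) {g : L →ₗ[F] L}
    (hg : ∀ a, ∀ x ∈ par a, ∀ y, φ x y = sgn F (γ * a) • g (br x y)) (h0 : ∀ c, g (X c) = 0) :
    φ = 0 := by
  have swap : ∀ {a b : ZMod 2} {x y : L}, x ∈ homBrackets par br a → y ∈ homBrackets par br b →
      br x (g y) = sgn F (γ * a) • br (g x) y := by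
    intro a b x y hx hy
    rw [factor_br h2 hB hφ hg hx hy, smul_smul, sgn_sq, one_smul]
  have hX : ∀ {a : ZMod 2} {w : L}, w ∈ homBrackets par br a → ∀ c, br (X c) (g w) = 0 := by
    intro a w hw c
    rw [swap (hf.X_mem_homBrackets hn c) hw, h0]
    simp
  obtain ⟨coord, hco⟩ := hf.exists_coord
  have hQ : ∀ a b, b ≠ a → b ≠ dual a → g (Q a b) = 0 := by
    intro a b h1 h1'
    have hQab := hf.Q_mem_homBrackets hn h1 h1'
    obtain ⟨v, hv⟩ := hf.exists_sum _ (hX hQab)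
    rw [hv]
    refine Finset.sum_eq_zero fun d _ => ?_
    -- `Q d' e` maps `X d` to a multiple of `X e`, while the image of `Q a b` on the span of the `X c`
    -- is spanned by `X a` and `X b`
    obtain ⟨e, he1, he2, he3, he4⟩ := exists_ne_four hn d (dual d) a b
    have he1' : e ≠ dual (dual d) := by rwa [dual_dual]
    have hQde := hf.Q_mem_homBrackets hn he2 he1'
    obtain ⟨w, hw⟩ := hf.exists_sum _ (hX hQde)
    obtain ⟨ε, δ, hε, h⟩ := hf.br_Q_sum he2 he1'
    obtain ⟨ε', δ', -, h'⟩ := hf.br_Q_sum h1 h1'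
    have key := swap hQde hQab
    rw [hB.skew _ _ _ (factor_mem_par hφ hg hQde) _ (mem_par_of_mem_homBrackets hB hQab), hv, hw,
      h, h'] at key
    have key' := congrArg (coord e) key
    simp only [map_add, map_smul, map_neg, hco, if_true, if_neg he2, if_neg he3, if_neg he4,
      dual_dual, smul_eq_mul, mul_one, mul_zero, add_zero, neg_zero] at key'
    rw [(mul_eq_zero.mp key').resolve_right hε, zero_smul]
  have hall : ∀ {a : ZMod 2} {w : L}, w ∈ homBrackets par br a → g w = 0 := by
    intro a w hw
    refine hf.eq_zero_of_commutes hn (hX hw) fun a b h1 h1' => ?_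
    rw [swap (hf.Q_mem_homBrackets hn h1 h1') hw, hQ a b h1 h1']
    simp
  refine LinearMap.ext fun x => LinearMap.ext fun y => ?_
  rw [LinearMap.zero_apply, LinearMap.zero_apply]
  refine homogeneous_induction hC (P := fun x => φ x y = 0) (fun x x' h h' => ?_)
    (fun a x hx => ?_) x
  · rw [map_add, LinearMap.add_apply, h, h', add_zero]
  refine homogeneous_induction hC (P := fun y => φ x y = 0) (fun y y' h h' => ?_)
    (fun b y hy => ?_) y
  · rw [map_add, h, h', add_zero]
  · rw [hg a x hx, hall ⟨a, b, x, hx, y, hy, rfl, rfl⟩, smul_zero]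

theorem exists_eq_smul (hn : 3 ≤ n) (h2 : (2 : F) ≠ 0) (hC : IsCompl (par 0) (par 1))
    (hB : IsSkewSuperBiderivation par br 0 br)
    (hφ : IsSkewSuperBiderivation par br γ φ) : ∃ r : F, φ = r • br := by
  obtain ⟨g, hg⟩ := exists_factor h2 hC hB (hf.eq_zero_of_commutes_brackets hn) hφ
  obtain ⟨r, hr, hX⟩ := hf.exists_factor_X hn h2 hC hB hφ hg
  refine ⟨r, sub_eq_zero.mp ?_⟩
  have hr' : ∀ a, sgn F (γ * a) * r = r := by
    intro a
    rcases zmod_two_cases γ with rfl | rfl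
    · rw [zero_mul, sgn_zero, one_mul]
    · rw [hr one_ne_zero, mul_zero]
  have hmem : r • br ∈ BDerHom par br γ := by
    rcases zmod_two_cases γ with rfl | rfl
    · exact Submodule.smul_mem _ r hB
    · rw [hr one_ne_zero, zero_smul]
      exact zero_mem _
  refine hf.eq_zero_of_factor_X_eq_zero (g := g - r • LinearMap.id) hn h2 hC hB
    (show φ - r • br ∈ BDerHom par br γ from sub_mem hφ hmem) (fun a x hx y => ?_) (fun c => ?_)
  · simp only [LinearMap.sub_apply, LinearMap.smul_apply, LinearMap.id_apply, smul_sub, smul_smul,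
      hr', hg a x hx]
  · simp [hX]

theorem BDer_eq_IBDer (hn : 3 ≤ n) (h2 : (2 : F) ≠ 0) (hC : IsCompl (par 0) (par 1))
    (hB : IsSkewSuperBiderivation par br 0 br) : BDer par br = IBDer br := by
  have hle : ∀ γ, BDerHom par br γ ≤ IBDer br := by
    intro γ φ hφ
    obtain ⟨r, rfl⟩ := hf.exists_eq_smul hn h2 hC hB hφ
    exact ⟨r, fun x y => by simp⟩
  refine le_antisymm (sup_le (hle 0) (hle 1)) ?_
  rintro φ ⟨r, hr⟩
  have : φ = r • br := LinearMap.ext fun x => LinearMap.ext fun y => by simp [hr]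
  rw [this]
  exact Submodule.mem_sup_left (Submodule.smul_mem (BDerHom par br 0) r hB)

end IsFrame
end Frames

/-! ### Associativity of `Λ(n,n)` and the Jacobi identity of `W(n,n)` -/

section VectorFields

variable {F : Type*} [Field F] {n : ℕ}

theorem single_eq_smul (m : Mon n) (c : F) :
    (Finsupp.single m c : Lam F n) = c • Finsupp.single m (1 : F) := by simp

theorem inversions_union_left {u v w : Finset (Fin n)} (h : Disjoint u v) :
    inversions (u ∪ v) w = inversions u w + inversions v w := by
  simp only [inversions, Finset.card_filter, Finset.sum_product]
  exact Finset.sum_union h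

theorem inversions_union_right {u v w : Finset (Fin n)} (h : Disjoint v w) :
    inversions u (v ∪ w) = inversions u v + inversions u w := by
  simp only [inversions, Finset.card_filter, Finset.sum_product_right]
  exact Finset.sum_union h

theorem choose_mul_choose_assoc (a b c : ℕ) :
    (a + b).choose a * (a + b + c).choose (a + b) =
      (b + c).choose b * (a + (b + c)).choose a := by
  have h := Nat.choose_mul (n := a + b + c) (k := a + b) (s := a)
  rw [show a + b + c - a = b + c by omega, show a + b - a = b by omega] at h
  rw [← add_assoc, mul_comm, h (Nat.le_add_right a b), mul_comm]

theorem mul_assoc_single (m m' m'' : Mon n) :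
    mul F n (mulMon F m m') (Finsupp.single m'' 1) =
      mul F n (Finsupp.single m 1) (mulMon F m' m'') := by
  obtain ⟨α, u⟩ := m
  obtain ⟨β, v⟩ := m'
  obtain ⟨δ, w⟩ := m''
  by_cases huv : Disjoint u v
  · by_cases hvw : Disjoint v w
    · simp only [mulMon, if_pos huv, if_pos hvw]
      rw [single_eq_smul, single_eq_smul (β + δ, v ∪ w)]
      simp only [map_smul, LinearMap.smul_apply, mul_single, mulMon, Finset.disjoint_union_left,
        Finset.disjoint_union_right, huv, hvw, and_true, true_and]
      by_cases huw : Disjoint u w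
      · simp only [if_pos huw, Finsupp.smul_single, smul_eq_mul, add_assoc, Finset.union_assoc]
        congr 1
        rw [inversions_union_left huv, inversions_union_right hvw, pow_add, pow_add]
        have h : (∏ i, ((α i + β i).choose (α i) : F)) *
              ∏ i, ((α i + (β i + δ i)).choose (α i + β i) : F) =
            (∏ i, ((β i + δ i).choose (β i) : F)) * ∏ i, ((α i + (β i + δ i)).choose (α i) : F) := by
          rw [← Finset.prod_mul_distrib, ← Finset.prod_mul_distrib]
          refine Finset.prod_congr rfl fun i _ => ?_
          rw [← Nat.cast_mul, ← Nat.cast_mul, ← choose_mul_choose_assoc, add_assoc]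
        simp only [Pi.add_apply, add_assoc]
        linear_combination ((-1) ^ inversions u v * (-1) ^ inversions u w *
          (-1) ^ inversions v w) * h
      · simp only [if_neg huw, smul_zero]
    · have h : ¬ Disjoint (u ∪ v) w := fun h => hvw (Finset.disjoint_union_left.mp h).2
      simp only [mulMon, if_pos huv, if_neg hvw, map_zero]
      rw [single_eq_smul, map_smul, LinearMap.smul_apply, mul_single, mulMon, if_neg h, smul_zero]
  · simp only [mulMon, if_neg huv, map_zero, LinearMap.zero_apply]
    split_ifs with hvw
    · have h : ¬ Disjoint u (v ∪ w) := fun h => huv (Finset.disjoint_union_right.mp h).1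
      rw [single_eq_smul (β + δ, v ∪ w), map_smul, mul_single, mulMon, if_neg h, smul_zero]
    · rw [map_zero]

theorem mul_assoc_Lam (f g h : Lam F n) :
    mul F n (mul F n f g) h = mul F n f (mul F n g h) := by
  induction f using Finsupp.induction_linear with
  | zero => simp
  | add f f' hf hf' => simp only [map_add, LinearMap.add_apply, hf, hf']
  | single m c =>
    induction g using Finsupp.induction_linear with
    | zero => simp
    | add g g' hg hg' => simp only [map_add, LinearMap.add_apply, hg, hg']
    | single m' c' =>
      induction h using Finsupp.induction_linear with
      | zero => simp
      | add h h' hh hh' => simp only [map_add, hh, hh']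
      | single m'' c'' =>
        rw [single_eq_smul m c, single_eq_smul m' c', single_eq_smul m'' c'']
        simp only [map_smul, LinearMap.smul_apply, mul_single, mul_assoc_single]

/-- The unit of `Λ(n,n)`. -/
noncomputable def one (F : Type*) [Field F] (n : ℕ) : Lam F n := Finsupp.single (0, ∅) 1

theorem one_mul_Lam (f : Lam F n) : mul F n (one F n) f = f := by
  induction f using Finsupp.induction_linear with
  | zero => simp
  | add f g hf hg => rw [map_add, hf, hg]
  | single m c =>
    rw [single_eq_smul, map_smul, one, mul_single]
    simp [mulMon, inversions]

theorem mul_one_Lam (f : Lam F n) : mul F n f (one F n) = f := by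
  induction f using Finsupp.induction_linear with
  | zero => simp
  | add f g hf hg => rw [map_add, LinearMap.add_apply, hf, hg]
  | single m c =>
    rw [single_eq_smul, map_smul, LinearMap.smul_apply, one, mul_single]
    simp [mulMon, inversions]

/-- The monomial of the generator `x_c`. -/
def genMon : Y n → Mon n
  | Sum.inl i => (Pi.single i 1, ∅)
  | Sum.inr i => (0, {i})

/-- The generator `x_c` of `Λ(n,n)`. -/
noncomputable def gen (F : Type*) [Field F] {n : ℕ} (c : Y n) : Lam F n := Finsupp.single (genMon c) 1

theorem gen_mem (c : Y n) : gen F c ∈ Par F n (tau c) := by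
  have h := single_mem_Par (F := F) (genMon c) 1
  rcases c with c | c <;> simpa [gen, genMon, tau] using h

theorem one_mem : one F n ∈ Par F n 0 := by
  simpa [one] using single_mem_Par (F := F) ((0, ∅) : Mon n) 1

theorem D_one (i : Y n) : D F i (one F n) = 0 := by
  rw [one, D_single]
  rcases i with i | i <;> simp [DMon]

theorem D_gen (i c : Y n) : D F i (gen F c) = if i = c then one F n else 0 := by
  rw [gen, D_single, one]
  rcases i with i | i <;> rcases c with c | c
  · by_cases h : i = c
    · subst h
      simp [DMon, genMon]
    · simp [DMon, genMon, h]
  · simp [DMon, genMon]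
  · simp [DMon, genMon]
  · by_cases h : i = c
    · subst h
      simp [DMon, genMon, Finset.filter_singleton]
    · simp [DMon, genMon, h]

theorem act_gen (A : W F n) (c : Y n) : act F n A (gen F c) = A c := by
  rw [act_apply, Finset.sum_eq_single c]
  · rw [D_gen, if_pos rfl, mul_one_Lam]
  · intro b _ hb
    rw [D_gen, if_neg hb, map_zero]
  · simp

theorem act_injective {A B : W F n} (h : ∀ f, act F n A f = act F n B f) : A = B :=
  funext fun c => by rw [← act_gen A c, ← act_gen B c, h]

theorem act_mem {a b : ZMod 2} {A : W F n} {f : Lam F n} (hA : ∀ j, A j ∈ Par F n (a + tau j))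
    (hf : f ∈ Par F n b) : act F n A f ∈ Par F n (a + b) := by
  rw [act_apply]
  refine Submodule.sum_mem _ fun i _ => ?_
  have h := mul_mem (hA i) (D_mem i hf)
  have e : ∀ a b t : ZMod 2, a + t + (b + t) = a + b := by decide
  rwa [e] at h

theorem act_mul {a b : ZMod 2} {A : W F n} {f : Lam F n} (hA : ∀ j, A j ∈ Par F n (a + tau j))
    (hf : f ∈ Par F n b) (g : Lam F n) :
    act F n A (mul F n f g) =
      mul F n (act F n A f) g + sgn F (a * b) • mul F n f (act F n A g) := by
  simp only [act_apply, map_sum, LinearMap.sum_apply]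
  rw [Finset.smul_sum, ← Finset.sum_add_distrib]
  refine Finset.sum_congr rfl fun i _ => ?_
  rw [D_mul i hf, map_add, map_smul, ← mul_assoc_Lam, ← mul_assoc_Lam, ← mul_assoc_Lam,
    mul_comm_par (hA i) hf, map_smul, LinearMap.smul_apply, smul_smul, ← sgn_add]
  congr 1
  apply smul_congr_sgn
  have e : ∀ a b t : ZMod 2, t * b + (a + t) * b = a * b := by decide
  exact e _ _ _

/-- The action of `W(n,n)` turns its bracket into the supercommutator. -/
theorem act_bracket {a b : ZMod 2} {A B : W F n} (hA : ∀ j, A j ∈ Par F n (a + tau j))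
    (hB : ∀ j, B j ∈ Par F n (b + tau j)) (f : Lam F n) :
    act F n (bracket F n A B) f =
      act F n A (act F n B f) - sgn F (a * b) • act F n B (act F n A f) := by
  -- the second order parts of the two products of operators agree
  have h2 : ∑ j, sgn F (a * (b + tau j)) • mul F n (B j) (act F n A (D F j f)) =
      sgn F (a * b) • ∑ i, sgn F (b * (a + tau i)) • mul F n (A i) (act F n B (D F i f)) := by
    simp only [act_apply, map_sum, Finset.smul_sum]
    rw [Finset.sum_comm]
    refine Finset.sum_congr rfl fun i _ => Finset.sum_congr rfl fun j _ => ?_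
    rw [← mul_assoc_Lam, ← mul_assoc_Lam, mul_comm_par (hB j) (hA i), D_comm i j f]
    simp only [map_smul, LinearMap.smul_apply, smul_smul, ← sgn_add]
    apply smul_congr_sgn
    have e : ∀ a b x y : ZMod 2, a * (b + y) + (x * y + (b + y) * (a + x)) =
        a * b + b * (a + x) := by decide
    exact e _ _ _ _
  have hAB : ∀ {a b : ZMod 2} {A B : W F n}, (∀ j, A j ∈ Par F n (a + tau j)) →
      (∀ j, B j ∈ Par F n (b + tau j)) → act F n A (act F n B f) =
        ∑ j, mul F n (act F n A (B j)) (D F j f) +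
          ∑ j, sgn F (a * (b + tau j)) • mul F n (B j) (act F n A (D F j f)) := by
    intro a b A B hA hB
    rw [act_apply B, map_sum, ← Finset.sum_add_distrib]
    exact Finset.sum_congr rfl fun j _ => act_mul hA (hB j) _
  rw [hAB hA hB, hAB hB hA, h2, smul_add, add_sub_add_right_eq_sub, act_apply, Finset.smul_sum,
    ← Finset.sum_sub_distrib]
  refine Finset.sum_congr rfl fun j _ => ?_
  rw [bracket_of_mem hA hB, map_sub, LinearMap.sub_apply, map_smul, LinearMap.smul_apply]

theorem bracket_mem {a b : ZMod 2} {A B : W F n} (hA : ∀ j, A j ∈ Par F n (a + tau j))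
    (hB : ∀ j, B j ∈ Par F n (b + tau j)) (j : Y n) :
    bracket F n A B j ∈ Par F n (a + b + tau j) := by
  rw [bracket_of_mem hA hB]
  refine sub_mem ?_ (Submodule.smul_mem _ _ ?_)
  · rw [add_assoc]
    exact act_mem hA (hB j)
  · rw [add_comm a b, add_assoc]
    exact act_mem hB (hA j)

theorem bracket_skew {a b : ZMod 2} {A B : W F n} (hA : ∀ j, A j ∈ Par F n (a + tau j))
    (hB : ∀ j, B j ∈ Par F n (b + tau j)) :
    bracket F n A B = -(sgn F (a * b) • bracket F n B A) := by
  funext j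
  rw [Pi.neg_apply, Pi.smul_apply, bracket_of_mem hA hB, bracket_of_mem hB hA, smul_sub, smul_smul,
    mul_comm b a, sgn_sq, one_smul, neg_sub]

theorem bracket_jacobi {a b c : ZMod 2} {A B C : W F n} (hA : ∀ j, A j ∈ Par F n (a + tau j))
    (hB : ∀ j, B j ∈ Par F n (b + tau j)) (hC : ∀ j, C j ∈ Par F n (c + tau j)) :
    bracket F n A (bracket F n B C) =
      bracket F n (bracket F n A B) C + sgn F (a * b) • bracket F n B (bracket F n A C) := by
  refine act_injective fun f => ?_
  rw [map_add, map_smul, LinearMap.add_apply, LinearMap.smul_apply,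
    act_bracket hA (bracket_mem hB hC), act_bracket (bracket_mem hA hB) hC,
    act_bracket hB (bracket_mem hA hC)]
  simp only [act_bracket hA hB, act_bracket hA hC, act_bracket hB hC, map_sub, map_smul, smul_sub,
    smul_smul, ← sgn_add]
  rcases zmod_two_cases a with rfl | rfl <;> rcases zmod_two_cases b with rfl | rfl <;>
  rcases zmod_two_cases c with rfl | rfl <;>
  simp only [one_add_one_zmod_two, sgn_zero, sgn_one, mul_zero, mul_one, add_zero, zero_add] <;>
  module

theorem mem_range_wproj {a : ZMod 2} {A : W F n} :
    A ∈ LinearMap.range (wproj F n a) ↔ ∀ j, A j ∈ Par F n (a + tau j) := by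
  constructor
  · rintro ⟨B, rfl⟩ j
    exact proj_mem _ _
  · intro h
    exact ⟨A, by rw [wproj_of_mem h, if_pos rfl]⟩

/-- The axioms of a Lie superalgebra for `W(n,n)`. -/
theorem isSkewSuperBiderivation_bracket :
    IsSkewSuperBiderivation (fun a => LinearMap.range (wproj F n a)) (bracket F n) 0
      (bracket F n) where
  homogeneous a b x hx y hy := by
    rw [mem_range_wproj] at *
    rw [add_zero]
    exact bracket_mem hx hy
  leibniz a b c x hx y hy z hz := by
    rw [mem_range_wproj] at hx hy hz
    rw [zero_add]
    exact bracket_jacobi hx hy hz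
  skew a b x hx y hy := by
    rw [mem_range_wproj] at hx hy
    rw [zero_mul, zero_mul, zero_add, zero_add]
    exact bracket_skew hx hy

theorem IsSkewSuperBiderivation.restrict {V : Type*} [AddCommGroup V] [Module F V]
    {par : ZMod 2 → Submodule F V} {br : V →ₗ[F] V →ₗ[F] V}
    (hB : IsSkewSuperBiderivation par br 0 br) {S : Submodule F V}
    (hS : ∀ x ∈ S, ∀ y ∈ S, br x y ∈ S) :
    IsSkewSuperBiderivation (fun a => (par a).comap S.subtype) (restrictBilin br S hS) 0
      (restrictBilin br S hS) where
  homogeneous a b x hx y hy := hB.homogeneous a b x hx y hy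
  leibniz a b c x hx y hy z hz := Subtype.ext (hB.leibniz a b c x hx y hy z hz)
  skew a b x hx y hy := Subtype.ext (hB.skew a b x hx y hy)

theorem isSkewSuperBiderivation_SHObracket {p : ℕ} [Fact p.Prime] [CharP F p] {t : Fin n → ℕ} :
    IsSkewSuperBiderivation (F := F) (L := SHO F p t) (SHOpar F p t) (SHObracket F p t) 0
      (SHObracket F p t) :=
  isSkewSuperBiderivation_bracket.restrict _

/-! ### The grading of `SHO(n,n;t)` by parity -/

theorem sum_wproj (A : W F n) : ∑ a : ZMod 2, wproj F n a A = A := by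
  funext j
  rw [Finset.sum_apply]
  exact (Equiv.sum_comp (Equiv.addRight (tau j)) fun a => proj F n a (A j)).trans (sum_proj _)

theorem wproj_TH (a : ZMod 2) (f : Lam F n) :
    wproj F n a (TH F n f) = TH F n (proj F n (a + 1) f) := by
  conv_lhs => rw [← sum_proj f]
  rw [map_sum, map_sum, Finset.sum_eq_single (a + 1)]
  · rw [wproj_of_mem (TH_mem (proj_mem _ _)), if_pos]
    rw [add_assoc, one_add_one_zmod_two, add_zero]
  · intro b _ hb
    rw [wproj_of_mem (TH_mem (proj_mem _ _)), if_neg]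
    rintro rfl
    exact hb (by rw [add_assoc, one_add_one_zmod_two, add_zero])
  · simp

theorem proj_mem_LamT {p : ℕ} {t : Fin n → ℕ} {f : Lam F n} (a : ZMod 2) (hf : f ∈ LamT F p t) :
    proj F n a f ∈ LamT F p t := by
  refine Submodule.span_induction ?_ ?_ ?_ ?_ hf
  · rintro _ ⟨m, hm, rfl⟩
    rw [proj_single]
    split_ifs
    · exact single_mem_LamT _ hm
    · exact zero_mem _
  · simp
  · intro x y _ _ hx hy
    rw [map_add]
    exact add_mem hx hy
  · intro c x _ hx
    rw [map_smul]
    exact Submodule.smul_mem _ _ hx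

theorem TH_mem_SHO' {p : ℕ} {t : Fin n → ℕ} {a : ZMod 2} {f : Lam F n} (hf : f ∈ Par F n a)
    (hT : f ∈ LamT F p t) (h0 : lap F n f = 0) : TH F n f ∈ SHO' F p t := by
  refine ⟨⟨fun j _ => ?_, ?_⟩, f, hT, rfl⟩
  · rw [TH_apply hf]
    exact Submodule.smul_mem _ _ (D_mem_LamT _ hT)
  · change div F n (TH F n f) = 0
    rw [div_TH_par hf, h0, smul_zero]

theorem wproj_mem_SHO' {p : ℕ} {t : Fin n → ℕ} (a : ZMod 2) {A : W F n} (hA : A ∈ SHO' F p t) :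
    wproj F n a A ∈ SHO' F p t := by
  obtain ⟨⟨-, h0⟩, f, hf, rfl⟩ := hA
  rw [wproj_TH]
  exact TH_mem_SHO' (proj_mem _ _) (proj_mem_LamT _ hf) (lap_proj_of_div h0 _)

theorem wproj_mem_derived {S : Submodule F (W F n)} (hS : ∀ a, ∀ A ∈ S, wproj F n a A ∈ S)
    (a : ZMod 2) (A : W F n) (hA : A ∈ derived S) : wproj F n a A ∈ derived S := by
  refine Submodule.span_induction ?_ ?_ ?_ ?_ hA
  · rintro _ ⟨x, hx, y, hy, rfl⟩
    rw [← sum_wproj x, ← sum_wproj y]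
    simp only [map_sum, LinearMap.sum_apply]
    refine Submodule.sum_mem _ fun b _ => Submodule.sum_mem _ fun c _ => ?_
    rw [wproj_of_mem (bracket_mem (mem_range_wproj.mp ⟨x, rfl⟩) (mem_range_wproj.mp ⟨y, rfl⟩))]
    split_ifs
    · exact Submodule.subset_span ⟨_, hS _ _ hx, _, hS _ _ hy, rfl⟩
    · exact zero_mem _
  · simp
  · intro x y _ _ hx hy
    rw [map_add]
    exact add_mem hx hy
  · intro c x _ hx
    rw [map_smul]
    exact Submodule.smul_mem _ _ hx

theorem wproj_mem_SHO {p : ℕ} {t : Fin n → ℕ} (a : ZMod 2) (A : W F n) (hA : A ∈ SHO F p t) :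
    wproj F n a A ∈ SHO F p t :=
  wproj_mem_derived (wproj_mem_derived fun a _ => wproj_mem_SHO' a) a A hA

theorem isCompl_SHOpar {p : ℕ} {t : Fin n → ℕ} :
    IsCompl (SHOpar F p t 0) (SHOpar F p t 1) := by
  constructor
  · rw [Submodule.disjoint_def]
    rintro ⟨A, hA⟩ h0 h1
    have h0' := wproj_of_mem (b := 0) (mem_range_wproj.mp h0)
    have h1' := wproj_of_mem (b := 0) (mem_range_wproj.mp h1)
    rw [if_pos rfl] at h0'
    rw [if_neg one_ne_zero] at h1'
    exact Subtype.ext (h0'.symm.trans h1')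
  · rw [codisjoint_iff, eq_top_iff]
    rintro ⟨A, hA⟩ -
    refine Submodule.mem_sup.mpr ⟨⟨_, wproj_mem_SHO 0 A hA⟩, ⟨A, rfl⟩, ⟨_, wproj_mem_SHO 1 A hA⟩,
      ⟨A, rfl⟩, Subtype.ext ?_⟩
    exact (Fin.sum_univ_two fun a : ZMod 2 => wproj F n a A).symm.trans (sum_wproj A)

end VectorFields

section SHOFrame

variable {F : Type*} [Field F] {n : ℕ}

theorem sgn_ne_zero (a : ZMod 2) : sgn F a ≠ 0 := fun h => by
  have := sgn_sq (F := F) a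
  rw [h, mul_zero] at this
  exact zero_ne_one this

/-! ### Functions with vanishing derivatives -/

theorem D_inl_apply (i : Fin n) (f : Lam F n) (α : Fin n → ℕ) (u : Finset (Fin n)) :
    D F (Sum.inl i) f (α, u) = f (α + Pi.single i 1, u) := by
  induction f using Finsupp.induction_linear with
  | zero => simp
  | add f g hf hg => rw [map_add, Finsupp.add_apply, Finsupp.add_apply, hf, hg]
  | single m c =>
    rw [single_eq_smul, map_smul, D_single, Finsupp.smul_apply, Finsupp.smul_apply]
    congr 1
    obtain ⟨β, v⟩ := m
    have h : β = α + Pi.single i 1 ↔ β i ≠ 0 ∧ β - Pi.single i 1 = α := by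
      constructor
      · rintro rfl
        exact ⟨by simp, by simp⟩
      · rintro ⟨h0, rfl⟩
        funext k
        by_cases hk : k = i
        · subst hk
          simp only [Pi.add_apply, Pi.sub_apply, Pi.single_eq_same]
          omega
        · simp [hk]
    simp only [DMon]
    by_cases h0 : β i = 0
    · rw [if_pos h0, Finsupp.zero_apply, Finsupp.single_eq_of_ne]
      intro e
      exact (h.mp (Prod.ext_iff.mp e).1.symm).1 h0
    · rw [if_neg h0]
      simp only [Finsupp.single_apply, Prod.mk.injEq, h]
      simp [h0]

theorem D_inr_apply (i : Fin n) (f : Lam F n) (α : Fin n → ℕ) {u : Finset (Fin n)} (hi : i ∉ u) :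
    D F (Sum.inr i) f (α, u) = (-1) ^ (u.filter (· < i)).card * f (α, insert i u) := by
  induction f using Finsupp.induction_linear with
  | zero => simp
  | add f g hf hg => rw [map_add, Finsupp.add_apply, Finsupp.add_apply, hf, hg, mul_add]
  | single m c =>
    rw [single_eq_smul, map_smul, D_single, Finsupp.smul_apply, Finsupp.smul_apply, smul_eq_mul,
      smul_eq_mul, mul_left_comm]
    congr 1
    obtain ⟨β, v⟩ := m
    simp only [DMon]
    by_cases hv : v = insert i u
    · subst hv
      rw [if_pos (Finset.mem_insert_self i u), Finset.erase_insert hi, Finset.filter_insert,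
        if_neg (lt_irrefl i)]
      simp [Finsupp.single_apply]
    · have h1 : (β, v) ≠ (α, insert i u) := fun e => hv (Prod.ext_iff.mp e).2
      rw [Finsupp.single_eq_of_ne h1.symm, mul_zero]
      split_ifs with h
      · rw [Finsupp.single_eq_of_ne]
        intro e
        have e2 : u = v.erase i := (Prod.ext_iff.mp e).2
        exact hv (by rw [e2, Finset.insert_erase h])
      · rfl

theorem eq_smul_one_of_D_eq_zero {f : Lam F n} (h : ∀ i, D F i f = 0) :
    f = f (0, ∅) • one F n := by
  ext ⟨α, u⟩
  rw [Finsupp.smul_apply, smul_eq_mul, one, Finsupp.single_apply]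
  by_cases hα : α = 0
  · by_cases hu : u = ∅
    · rw [hα, hu, if_pos rfl, mul_one]
    · obtain ⟨i, hi⟩ := Finset.nonempty_iff_ne_empty.mpr hu
      have h' := D_inr_apply i f α (Finset.notMem_erase i u)
      rw [h, Finset.insert_erase hi, Finsupp.zero_apply] at h'
      rw [(mul_eq_zero.mp h'.symm).resolve_left (by simp), if_neg, mul_zero]
      exact fun e => hu (Prod.ext_iff.mp e).2.symm
  · obtain ⟨i, hi⟩ := Function.ne_iff.mp hα
    have h' := D_inl_apply i f (α - Pi.single i 1) u
    have e : α - Pi.single i 1 + Pi.single i 1 = α := by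
      funext k
      by_cases hk : k = i
      · subst hk
        simp only [Pi.add_apply, Pi.sub_apply, Pi.single_eq_same, Pi.zero_apply] at hi ⊢
        omega
      · simp [hk]
    rw [h, e, Finsupp.zero_apply] at h'
    rw [← h', if_neg, mul_zero]
    exact fun e => hα (Prod.ext_iff.mp e).1.symm

theorem D_TH (e j : Y n) (f : Lam F n) : D F e (TH F n f j) = TH F n (D F e f) j := by
  rw [← sum_proj f]
  simp only [map_sum, Finset.sum_apply]
  refine Finset.sum_congr rfl fun a _ => ?_
  rw [TH_apply (proj_mem a f), TH_apply (D_mem e (proj_mem a f)), map_smul, D_comm e, smul_smul,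
    ← sgn_add]
  exact smul_congr_sgn (by ring) _

/-! ### Linear and quadratic Hamiltonians -/

theorem TH_one : TH F n (one F n) = 0 := by
  funext j
  rw [TH_apply one_mem, D_one, smul_zero, Pi.zero_apply]

theorem TH_gen_apply (c j : Y n) :
    TH F n (gen F c) j = if j = dual c then sgn F (tau c) • one F n else 0 := by
  rw [TH_apply (gen_mem c), D_gen]
  by_cases h : j = dual c
  · subst h
    rw [dual_dual, if_pos rfl, if_pos rfl]
    have e : ∀ x : ZMod 2, x * x = x := by decide
    rw [e]
  · rw [if_neg h, if_neg (fun h' => h (by rw [← h', dual_dual])), smul_zero]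

theorem act_TH_gen (c : Y n) (g : Lam F n) :
    act F n (TH F n (gen F c)) g = sgn F (tau c) • D F (dual c) g := by
  rw [act_apply, Finset.sum_eq_single (dual c)]
  · rw [TH_gen_apply, if_pos rfl, map_smul, LinearMap.smul_apply, one_mul_Lam]
  · intro b _ hb
    rw [TH_gen_apply, if_neg hb, map_zero, LinearMap.zero_apply]
  · simp

/-- The product `x_a x_b` of two generators. -/
noncomputable def quad (F : Type*) [Field F] {n : ℕ} (a b : Y n) : Lam F n :=
  mul F n (gen F a) (gen F b)

theorem quad_mem (a b : Y n) : quad F a b ∈ Par F n (tau a + tau b) := mul_mem (gen_mem a) (gen_mem b)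

theorem D_quad (i a b : Y n) :
    D F i (quad F a b) =
      (if i = a then gen F b else 0) + if i = b then sgn F (tau i * tau a) • gen F a else 0 := by
  rw [quad, D_mul i (gen_mem a), D_gen, D_gen]
  congr 1
  · split_ifs
    · rw [one_mul_Lam]
    · rw [map_zero, LinearMap.zero_apply]
  · split_ifs
    · rw [mul_one_Lam]
    · rw [map_zero, smul_zero]

theorem lap_quad {a b : Y n} (h : b ≠ dual a) : lap F n (quad F a b) = 0 := by
  rw [lap_apply]
  refine Finset.sum_eq_zero fun i _ => ?_
  rw [D_quad, map_add]
  have e1 : D F i (if dual i = a then gen F b else 0) = 0 := by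
    split_ifs with h1
    · rw [D_gen, if_neg]
      rintro rfl
      exact h (by rw [← h1, dual_dual])
    · rw [map_zero]
  have e2 : D F i (if dual i = b then sgn F (tau (dual i) * tau a) • gen F a else 0) = 0 := by
    split_ifs with h1
    · rw [map_smul, D_gen, if_neg, smul_zero]
      rintro rfl
      exact h h1.symm
    · rw [map_zero]
  rw [e1, e2, add_zero]

theorem act_TH_quad (a b : Y n) : ∃ r s : F, r ≠ 0 ∧ s ≠ 0 ∧ ∀ g, act F n (TH F n (quad F a b)) g =
    r • mul F n (gen F b) (D F (dual a) g) + s • mul F n (gen F a) (D F (dual b) g) := by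
  refine ⟨sgn F (tau a * (tau a + tau b)), sgn F (tau b * (tau a + tau b) + tau b * tau a),
    sgn_ne_zero _, sgn_ne_zero _, fun g => ?_⟩
  rw [act_TH_apply (quad_mem a b), ← Equiv.sum_comp dual]
  simp only [dual_dual, D_quad, map_add, LinearMap.add_apply, smul_add, Finset.sum_add_distrib]
  congr 1
  · rw [Finset.sum_eq_single a]
    · rw [if_pos rfl]
    · intro i _ hi
      rw [if_neg hi, map_zero, LinearMap.zero_apply, smul_zero]
    · simp
  · rw [Finset.sum_eq_single b]
    · rw [if_pos rfl, map_smul, LinearMap.smul_apply, smul_smul, ← sgn_add]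
    · intro i _ hi
      rw [if_neg hi, map_zero, LinearMap.zero_apply, smul_zero]
    · simp

theorem bracket_gen_gen (a b : Y n) : bracket F n (TH F n (gen F a)) (TH F n (gen F b)) = 0 := by
  rw [bracket_TH, act_TH_gen, D_gen, map_smul]
  split_ifs
  · rw [TH_one, smul_zero]
  · rw [map_zero, smul_zero]

theorem bracket_quad_gen_left {a b : Y n} (h : b ≠ a) : ∃ ε : F, ε ≠ 0 ∧
    bracket F n (TH F n (quad F a b)) (TH F n (gen F (dual a))) = ε • TH F n (gen F b) := by
  obtain ⟨r, s, hr, -, e⟩ := act_TH_quad (F := F) a b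
  refine ⟨r, hr, ?_⟩
  rw [bracket_TH, e, D_gen, D_gen, if_pos rfl, if_neg (fun h' => h (dual.injective h')), mul_one_Lam,
    map_zero, smul_zero, add_zero, map_smul]

theorem bracket_quad_gen_right {a b : Y n} (h : b ≠ a) : ∃ ε : F,
    bracket F n (TH F n (quad F a b)) (TH F n (gen F (dual b))) = ε • TH F n (gen F a) := by
  obtain ⟨r, s, -, -, e⟩ := act_TH_quad (F := F) a b
  refine ⟨s, ?_⟩
  rw [bracket_TH, e, D_gen, D_gen, if_pos rfl, if_neg (fun h' => h (dual.injective h').symm),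
    mul_one_Lam, map_zero, smul_zero, zero_add, map_smul]

theorem bracket_quad_gen_of_ne {a b c : Y n} (h1 : c ≠ dual a) (h2 : c ≠ dual b) :
    bracket F n (TH F n (quad F a b)) (TH F n (gen F c)) = 0 := by
  obtain ⟨r, s, -, -, e⟩ := act_TH_quad (F := F) a b
  rw [bracket_TH, e, D_gen, D_gen, if_neg h1.symm, if_neg h2.symm]
  simp

theorem bracket_quad_quad {a b c : Y n} (h1 : b ≠ dual a) (h2 : c ≠ dual a) (h3 : c ≠ b) :
    ∃ ε : F, ε ≠ 0 ∧ bracket F n (TH F n (quad F a (dual c))) (TH F n (quad F c b)) =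
      ε • TH F n (quad F a b) := by
  obtain ⟨r, s, -, hs, e⟩ := act_TH_quad (F := F) a (dual c)
  refine ⟨s, hs, ?_⟩
  rw [bracket_TH, e, D_quad, D_quad, if_neg h2.symm, if_neg h1.symm, dual_dual, if_pos rfl,
    if_neg h3, add_zero, add_zero, map_zero, smul_zero, zero_add, map_smul, quad]

/-! ### The frame of `SHO(n,n;t)` -/

theorem gen_mem_LamT {p : ℕ} (hp : 2 < p) {t : Fin n → ℕ} (ht : ∀ i, 1 ≤ t i) (c : Y n) :
    gen F c ∈ LamT F p t := by
  have h : ∀ i, 1 ≤ p ^ t i - 1 := by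
    intro i
    have := Nat.le_self_pow (Nat.one_le_iff_ne_zero.mp (ht i)) p
    omega
  refine single_mem_LamT _ fun i => ?_
  rcases c with c | c
  · by_cases hi : i = c
    · subst hi
      simpa [genMon] using h i
    · simp [genMon, hi]
  · simp [genMon]

/-- The Hamiltonian vector fields of the `x_c` and of the `x_a x_b` with `b ≠ a, a'` are brackets of each
other up to scalars, so a subspace that contains all of them shares this with its derived space. -/
theorem gen_quad_mem_derived (hn : 3 ≤ n) {A : Submodule F (W F n)}
    (hX : ∀ c : Y n, TH F n (gen F c) ∈ A)
    (hQ : ∀ a b : Y n, b ≠ a → b ≠ dual a → TH F n (quad F a b) ∈ A) :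
    (∀ c : Y n, TH F n (gen F c) ∈ derived A) ∧
      ∀ a b : Y n, b ≠ a → b ≠ dual a → TH F n (quad F a b) ∈ derived A := by
  have key : ∀ {x y z : W F n}, x ∈ A → y ∈ A → (∃ ε : F, ε ≠ 0 ∧ bracket F n x y = ε • z) →
      z ∈ derived A := by
    rintro x y z hx hy ⟨ε, hε, h⟩
    rw [← one_smul F z, ← inv_mul_cancel₀ hε, mul_smul, ← h]
    exact Submodule.smul_mem _ _ (Submodule.subset_span ⟨x, hx, y, hy, rfl⟩)
  constructor
  · intro c
    obtain ⟨d, hd1, hd2, -, -⟩ := exists_ne_four hn c (dual c) c c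
    exact key (hQ d c hd1.symm (ne_dual_comm hd2)) (hX _) (bracket_quad_gen_left hd1.symm)
  · intro a b h1 h2
    obtain ⟨c, hc1, hc2, hc3, hc4⟩ := exists_ne_four hn a (dual a) b (dual b)
    exact key (hQ a (dual c) (ne_dual_comm hc2).symm (fun h => hc1 (dual.injective h)))
      (hQ c b hc3.symm (ne_dual_comm hc4)) (bracket_quad_quad h2 hc2 hc3)

variable {p : ℕ} [Fact p.Prime] [CharP F p] {t : Fin n → ℕ}

theorem gen_quad_mem_SHO (hp : 2 < p) (hn : 3 ≤ n) (ht : ∀ i, 1 ≤ t i) :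
    (∀ c : Y n, TH F n (gen F c) ∈ SHO F p t) ∧
      ∀ a b : Y n, b ≠ a → b ≠ dual a → TH F n (quad F a b) ∈ SHO F p t := by
  have hX : ∀ c : Y n, TH F n (gen F c) ∈ SHO' F p t := fun c =>
    TH_mem_SHO' (gen_mem c) (gen_mem_LamT hp ht c) (by
      rw [lap_apply]
      refine Finset.sum_eq_zero fun i _ => ?_
      rw [D_gen]
      split_ifs
      · exact D_one i
      · exact map_zero _)
  have hQ : ∀ a b : Y n, b ≠ a → b ≠ dual a → TH F n (quad F a b) ∈ SHO' F p t :=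
    fun a b _ h => TH_mem_SHO' (quad_mem a b)
      (mul_mem_LamT (gen_mem_LamT hp ht a) (gen_mem_LamT hp ht b)) (lap_quad h)
  have h := gen_quad_mem_derived hn hX hQ
  exact gen_quad_mem_derived hn h.1 h.2

theorem SHO_le_HO : SHO F p t ≤ HO F p t := by
  refine le_trans ((derived_le ?_).trans (derived_le fun _ hx _ hy => bracket_mem_SHO' hx hy))
    inf_le_right
  exact bracket_mem_derived fun _ hx _ hy => bracket_mem_SHO' hx hy

/-- The coefficient of the Hamiltonian vector field of `x_c`, that is, up to sign the constant term
of the component at `c'`. -/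
noncomputable def linCoeff (F : Type*) [Field F] {n : ℕ} (c : Y n) : W F n →ₗ[F] F :=
  sgn F (tau c) • (Finsupp.lapply ((0, ∅) : Mon n) ∘ₗ LinearMap.proj (dual c))

theorem linCoeff_TH_gen (c d : Y n) : linCoeff F c (TH F n (gen F d)) = if c = d then 1 else 0 := by
  simp only [linCoeff, LinearMap.smul_apply, LinearMap.comp_apply, LinearMap.proj_apply,
    TH_gen_apply, dual.injective.eq_iff]
  split_ifs with h
  · subst h
    simp [one, sgn_sq]
  · simp

theorem eq_sum_of_commutes_gen {f : Lam F n}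
    (h : ∀ c, bracket F n (TH F n (gen F c)) (TH F n f) = 0) :
    TH F n f = ∑ c, linCoeff F c (TH F n f) • TH F n (gen F c) := by
  have hD : ∀ e j, D F e (TH F n f j) = 0 := by
    intro e j
    have h' := h (dual e)
    rw [bracket_TH, act_TH_gen, map_smul, dual_dual] at h'
    rw [D_TH, (smul_eq_zero.mp h').resolve_left (sgn_ne_zero _), Pi.zero_apply]
  funext j
  rw [Finset.sum_apply, Finset.sum_eq_single (dual j)]
  · rw [Pi.smul_apply, TH_gen_apply, dual_dual, if_pos rfl, smul_smul]
    conv_lhs => rw [eq_smul_one_of_D_eq_zero fun e => hD e j]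
    congr 1
    simp only [linCoeff, LinearMap.smul_apply, LinearMap.comp_apply, LinearMap.proj_apply,
      Finsupp.lapply_apply, dual_dual, smul_eq_mul]
    rw [mul_right_comm, sgn_sq, one_mul]
  · intro c _ hc
    rw [Pi.smul_apply, TH_gen_apply, if_neg, smul_zero]
    rintro rfl
    exact hc (dual_dual c).symm
  · simp

open Classical in
theorem exists_isFrame_SHO (hp : 2 < p) (hn : 3 ≤ n) (ht : ∀ i, 1 ≤ t i) :
    ∃ (X : Y n → SHO F p t) (Q : Y n → Y n → SHO F p t),
      IsFrame (F := F) (L := SHO F p t) (SHOpar F p t) (SHObracket F p t) X Q := by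
  obtain ⟨hX, hQ⟩ := gen_quad_mem_SHO (F := F) hp hn ht
  -- `IsFrame` says nothing about the pairs with `b = a` or `b = a'`, where `Q a b` is set to `0`
  refine ⟨fun c => ⟨_, hX c⟩, fun a b =>
    if h : b ≠ a ∧ b ≠ dual a then ⟨_, hQ a b h.1 h.2⟩ else 0, ?_⟩
  constructor
  · exact fun c => mem_range_wproj.mpr (TH_mem (gen_mem c))
  · intro a b h1 h2
    rw [dif_pos ⟨h1, h2⟩]
    exact mem_range_wproj.mpr (TH_mem (quad_mem a b))
  · exact fun a b => Subtype.ext (bracket_gen_gen a b)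
  · intro a b h1 h2
    rw [dif_pos ⟨h1, h2⟩]
    obtain ⟨ε, hε, e⟩ := bracket_quad_gen_left (F := F) h1
    exact ⟨ε, hε, Subtype.ext e⟩
  · intro a b h1 h2
    rw [dif_pos ⟨h1, h2⟩]
    obtain ⟨ε, e⟩ := bracket_quad_gen_right (F := F) h1
    exact ⟨ε, Subtype.ext e⟩
  · intro a b c h1 h2 h3 h4
    rw [dif_pos ⟨h1, h2⟩]
    exact Subtype.ext (bracket_quad_gen_of_ne h3 h4)
  · intro a b c h1 h2 h3 h4 h5 h6
    rw [dif_pos ⟨(ne_dual_comm h4).symm, fun h => h3 (dual.injective h)⟩,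
      dif_pos ⟨h5.symm, ne_dual_comm h6⟩, dif_pos ⟨h1, h2⟩]
    obtain ⟨ε, hε, e⟩ := bracket_quad_quad (F := F) h2 h4 h5
    exact ⟨ε, hε, Subtype.ext e⟩
  · exact ⟨fun c => linCoeff F c ∘ₗ (SHO F p t).subtype, fun c d => linCoeff_TH_gen c d⟩
  · rintro ⟨z, hz⟩ h
    obtain ⟨f, -, rfl⟩ := SHO_le_HO hz
    refine ⟨fun c => linCoeff F c (TH F n f), Subtype.ext ?_⟩
    rw [AddSubmonoidClass.coe_finsetSum]
    exact eq_sum_of_commutes_gen fun c => congrArg Subtype.val (h c)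

end SHOFrame

end OddHamiltonian

theorem mainTheorem1 (F : Type*) [Field F] (p : ℕ) [Fact p.Prime] [CharP F p] (hp : 2 < p)
    (n : ℕ) (hn : 3 ≤ n) (t : Fin n → ℕ) (ht : ∀ i, 1 ≤ t i) :
    OddHamiltonian.BDer (F := F) (L := OddHamiltonian.SHO F p t)
        (OddHamiltonian.SHOpar F p t) (OddHamiltonian.SHObracket F p t) =
      OddHamiltonian.IBDer (F := F) (L := OddHamiltonian.SHO F p t)
        (OddHamiltonian.SHObracket F p t) := by
  obtain ⟨X, Q, hf⟩ := OddHamiltonian.exists_isFrame_SHO (F := F) hp hn ht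
  have h2 : (2 : F) ≠ 0 := by
    intro h
    have h' := (CharP.cast_eq_zero_iff F p 2).mp (by exact_mod_cast h)
    exact absurd (Nat.le_of_dvd two_pos h') (by omega)
  exact hf.BDer_eq_IBDer hn h2 OddHamiltonian.isCompl_SHOpar
    OddHamiltonian.isSkewSuperBiderivation_SHObracket
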